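/- All graphs are finite and simple; $d(v)$ denotes the degree of a vertex $v$. A caterpillar is a tree obtained from a path $P$ with at least one vertex by adding a (possibly empty) set of new vertices and making each new vertex adjacent to one vertex of $P$. For an integer $k\ge 2$ let $\mathcal C_k$ be the class of all graphs of maximum degree at most $k$ each of whose connected components is a caterpillar, and let $\alpha_{\mathcal C_k}(G)$ be the maximum number of vertices of an induced subgraph of $G$ that belongs to $\mathcal C_k$. A function $f:\mathbb N\to[0,1]$ (where $0\in\mathbb N$) is a lower bound for $\alpha_{\mathcal C_k}$ if $\alpha_{\mathcal C_k}(G)\ge\sum_{v\in V(G)}f(d(v))$ for every graph $G$. It is extremal if there is no $g:\mathbb N\to[0,1]$, not identically zero, such that $f+g$ is also a lower bound for $\alpha_{\mathcal C_k}$. A lower bound $f$ is dominated by a lower bound $f'$ if $f(d)\le f'(d)$ for all $d\in\mathbb N$. Theorem. Let $k\ge2$ be an integer. For every real $\varepsilon$ with $0\le\varepsilon\le\frac{2}{(k+1)(k+2)}$, the function $$f_{k,\varepsilon}(d)=\begin{cases}1&\text{if } d=0,\\ 1-\varepsilon&\text{if } d=1,\\ \frac{2}{d+1}&\text{if } 2\le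 d\le k,\\ \min\left\{(k+1)\varepsilon,\frac{2}{d+1}\right\}&\text{if } d\ge k+1\end{cases}$$ is an extremal lower bound for $\alpha_{\mathcal C_k}$. Furthermore, every lower bound for $\alpha_{\mathcal C_k}$ is dominated by $f_{k,\varepsilon}$ for some $\varepsilon$ with $0\le\varepsilon\le\frac{2}{(k+1)(k+2)}$. -/

import Mathlib

/-- A class of finite simple graphs. Finite graphs are represented on vertex types in `Type`, which
covers all finite graphs up to isomorphism. -/
abbrev GraphClass : Type 1 := ∀ (V : Type) [Fintype V], SimpleGraph V → Prop

/-- `H` is a caterpillar: a tree containing a path `p` (with at least one vertex) such that every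
vertex not on `p` is adjacent to one vertex of `p` and to nothing else, i.e. a tree obtained from a
path by adding new vertices, each made adjacent to a vertex of the path. -/
def IsCaterpillar {V : Type} (H : SimpleGraph V) : Prop :=
  H.IsTree ∧ ∃ (u v : V) (p : H.Walk u v), p.IsPath ∧
    ∀ x, x ∉ p.support → ∃ y ∈ p.support, ∀ z, H.Adj x z ↔ z = y

open Classical in
/-- The class of forests of caterpillars of maximum degree at most `k`: every connected component is
a caterpillar (in particular a tree), and every vertex has degree at most `k`. -/
def caterpillarForests (k : ℕ) : GraphClass := fun V _ H =>
  (∀ c : H.ConnectedComponent, IsCaterpillar c.toSimpleGraph) ∧ ∀ v : V, H.degree v ≤ k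

open Classical in
/-- The maximum order of an induced subgraph of `G` that belongs to `C`. -/
noncomputable def maxInducedOrder (C : GraphClass) {V : Type} [Fintype V]
    (G : SimpleGraph V) : ℕ :=
  (Finset.univ.filter fun S : Finset V => C S (G.induce (S : Set V))).sup Finset.card

open Classical in
/-- The quantity `f(G)`, the sum of `f (d(v))` over all vertices `v` of `G`. -/
noncomputable def degreeSum (f : ℕ → ℝ) {V : Type} [Fintype V] (G : SimpleGraph V) : ℝ :=
  ∑ v : V, f (G.degree v)

/-- `f : ℕ → [0,1]` is a lower bound for the parameter attached to `C`. -/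
def IsLowerBoundFor (C : GraphClass) (f : ℕ → ℝ) : Prop :=
  (∀ d, f d ∈ Set.Icc (0 : ℝ) 1) ∧
    ∀ (V : Type) [Fintype V] (G : SimpleGraph V), degreeSum f G ≤ (maxInducedOrder C G : ℝ)

/-- A lower bound that cannot be augmented by any `g : ℕ → [0,1]` that is not identically zero. -/
def IsExtremalLowerBoundFor (C : GraphClass) (f : ℕ → ℝ) : Prop :=
  IsLowerBoundFor C f ∧
    ¬ ∃ g : ℕ → ℝ, (∀ d, g d ∈ Set.Icc (0 : ℝ) 1) ∧ (∃ d, g d ≠ 0) ∧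
      IsLowerBoundFor C (fun d => f d + g d)

/-- The function `f_{k,ε}`. -/
noncomputable def caterpillarBound (k : ℕ) (ε : ℝ) (d : ℕ) : ℝ :=
  if d = 0 then 1
  else if d = 1 then 1 - ε
  else if d ≤ k then 2 / ((d : ℝ) + 1)
  else min (((k : ℝ) + 1) * ε) (2 / ((d : ℝ) + 1))

/-!
The lower bound reduces to a statement about graphs with capacities. All vertices of degree at most
`1` are selected. A remaining vertex with `l` neighbours of degree `1` gets the capacity
`r = min 3 (k + 1 - l)`. If `I` is a set of remaining vertices that induces a forest in which every
vertex `y` has fewer than `r y` neighbours (`IsGood`), then `I` together with the vertices of degree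
at most `1` induces a forest of maximum degree at most `k` in which no vertex has three inner
neighbours, and such a forest consists of caterpillars (`isCaterpillar_of_isTree`,
`caterpillarForests_induce`). The value `1 - ε` at a leaf means that each leaf passes `ε` on to its
neighbour; after that, every remaining vertex needs at most the weight `wt r d` of its capacity `r`
and its degree `d` among the remaining vertices (`caterpillarBound_sub_le_wt`). It is therefore
enough that a graph with capacities at most `3` contains a good set at least as large as its total
weight (`hasGood`).

This is proved by induction on the number of vertices. For most values the weight satisfies
`wt r (d - 1) - wt r d = wt r d / d`, so the deletion of a vertex for which `wt r d / d` is minimal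
does not decrease the total weight: each of its neighbours gains at least the weight per edge of the
deleted vertex (`HasGood.of_min`, `wt_step`). Neighbours of capacity `3` and degree `2` gain nothing.
They are selected in the same step, as they are left with at most one neighbour, which then loses a
unit of capacity. The step fails in a few configurations, which are removed by reductions of their
own: vertices of degree `1` and of capacity `1` or `3`, an ear of capacity `3` on an edge with an
end of capacity `1` (`HasGood.of_ear`), a certain triangle (`HasGood.of_triangle`), and two
four-cycles. The reduction of an ear would lose `1 / 18` at a vertex of capacity `1` and degree `2`,
so the weight of such a vertex is lowered by this amount in the induction (`IsTight`, `cwt`), and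
every reduction has to pay for the vertices that it makes tight (`sum_cwt_le_sum_cwt`,
`card_tight_mul_le`). If there is no vertex to delete, then every
degree is less than the capacity, and it only remains to break cycles (`HasGood.of_card_lt`).

Conversely, a lower bound `φ` satisfies `φ d ≤ 2 / (d + 1)` because of the complete graph on `d + 1`
vertices, and `φ d ≤ (k + 1) (1 - φ 1)` for `d > k` because of a complete graph with `k + 1` pendant
vertices at each vertex (`pendantComplete`). Hence it is dominated by `f_{k,ε}` where `ε` is
`1 - φ 1`, or the largest admissible value if that is smaller. Extremality follows, since no two of
the functions `f_{k,ε}` are comparable.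
-/


namespace CaterpillarForest

open Finset
open scoped Classical

variable {V : Type} {G : SimpleGraph V}

/-! ### Capacities, weights and good sets -/

/-- The neighbours of `v` inside the vertex set `S`. -/
noncomputable def nb (G : SimpleGraph V) (S : Finset V) (v : V) : Finset V :=
  S.filter (G.Adj v)

/-- An induced forest with capacities: every `y ∈ I` has fewer than `r y` neighbours in `I`,
and `I` induces a forest. Acyclicity is expressed by degeneracy: every nonempty subset of `I` has a
vertex with at most one neighbour in that subset. -/
structure IsGood (G : SimpleGraph V) (r : V → ℕ) (I : Finset V) : Prop where
  card_lt : ∀ y ∈ I, (nb G I y).card < r y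
  sparse : ∀ T ⊆ I, T.Nonempty → ∃ x ∈ T, (nb G T x).card ≤ 1

/-- The weight of a vertex of capacity `r ≤ 3` and degree `d`. It is `(2 / 3) r / (d + 1)` with
three exceptions: an isolated vertex of capacity `2` or `3` weighs `1`, and a vertex of capacity `3`
and degree `1` weighs `2 / 3`. Away from the exceptions, `wt r (d - 1) - wt r d = wt r d / d`. -/
noncomputable def wt (r d : ℕ) : ℝ :=
  if 2 ≤ r ∧ d = 0 then 1 else if 3 ≤ r ∧ d = 1 then 2 / 3 else 2 * r / (3 * (d + 1))

/-- A vertex of capacity `1` and degree `2` whose two neighbours are adjacent, one of them being of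
capacity `3` and degree `2`. In such a triangle the uncorrected weight `2 / 9` of the vertex is more
than the reduction `HasGood.of_ear` can afford. -/
def IsTight (G : SimpleGraph V) (S : Finset V) (r : V → ℕ) (y : V) : Prop :=
  r y = 1 ∧ (nb G S y).card = 2 ∧
    ∃ u ∈ nb G S y, r u = 3 ∧ (nb G S u).card = 2 ∧ ∃ v ∈ nb G S y, G.Adj u v

/-- The corrected weight of a vertex: tight vertices weigh `2 / 9 - 1 / 18 = 1 / 6`. -/
noncomputable def cwt (G : SimpleGraph V) (S : Finset V) (r : V → ℕ) (y : V) : ℝ :=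
  wt (r y) (nb G S y).card - if IsTight G S r y then 1 / 18 else 0

/-- The capacities left once the vertices of `K` have been selected. The subtraction is truncated:
a vertex of capacity `0` cannot be selected any more. -/
noncomputable def rest (G : SimpleGraph V) (K : Finset V) (r : V → ℕ) (y : V) : ℕ :=
  r y - (nb G K y).card

/-- `S` contains a good set whose size is at least the total corrected weight. -/
def HasGood (G : SimpleGraph V) (S : Finset V) (r : V → ℕ) : Prop :=
  ∃ I ⊆ S, IsGood G r I ∧ ∑ y ∈ S, cwt G S r y ≤ (I.card : ℝ)

theorem mem_nb {S : Finset V} {v u : V} : u ∈ nb G S v ↔ u ∈ S ∧ G.Adj v u := by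
  simp [nb]

theorem nb_mono {S T : Finset V} (h : S ⊆ T) (v : V) : nb G S v ⊆ nb G T v :=
  filter_subset_filter _ h

theorem nb_union (S T : Finset V) (v : V) : nb G (S ∪ T) v = nb G S v ∪ nb G T v :=
  filter_union _ _ _

theorem card_nb_union {S T : Finset V} (h : Disjoint S T) (v : V) :
    (nb G (S ∪ T) v).card = (nb G S v).card + (nb G T v).card := by
  rw [nb_union]
  exact card_union_of_disjoint (disjoint_filter_filter h)

theorem card_nb_sdiff_add {S X : Finset V} (h : X ⊆ S) (v : V) :
    (nb G (S \ X) v).card + (nb G X v).card = (nb G S v).card := by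
  rw [← card_nb_union disjoint_sdiff_self_left, sdiff_union_of_subset h]

theorem nb_comm_card_sum (S T : Finset V) :
    ∑ y ∈ S, (nb G T y).card = ∑ u ∈ T, (nb G S u).card := by
  have := Finset.sum_card_bipartiteAbove_eq_sum_card_bipartiteBelow (s := S) (t := T) G.Adj
  simpa [bipartiteAbove, bipartiteBelow, nb, G.adj_comm] using this

/-- Selecting `K` and discarding `X \ K`: a good set for the remaining vertices and the remaining
capacities extends by `K`. -/
theorem IsGood.union {S X K I : Finset V} {r : V → ℕ} (hKX : K ⊆ X) (hI : I ⊆ S \ X)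
    (hgood : IsGood G (rest G K r) I)
    (hdeg : ∀ x ∈ K, (nb G (S \ X ∪ K) x).card < r x)
    (hsp : ∀ T ⊆ K, T.Nonempty → ∃ x ∈ T, (nb G (S \ X ∪ T) x).card ≤ 1) :
    IsGood G r (I ∪ K) := by
  have hdis : Disjoint I K := by
    rw [disjoint_left]
    intro a ha hK
    exact (mem_sdiff.1 (hI ha)).2 (hKX hK)
  refine ⟨fun y hy => ?_, fun T hT hne => ?_⟩
  · rcases mem_union.1 hy with hy | hy
    · have := hgood.card_lt y hy
      rw [card_nb_union hdis]
      unfold rest at this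
      omega
    · exact (card_le_card (nb_mono (union_subset_union_left hI) y)).trans_lt (hdeg y hy)
  · by_cases hTK : (T ∩ K).Nonempty
    · obtain ⟨x, hx, hc⟩ := hsp (T ∩ K) inter_subset_right hTK
      refine ⟨x, (mem_inter.1 hx).1, (card_le_card (nb_mono ?_ x)).trans hc⟩
      intro a ha
      rcases mem_union.1 (hT ha) with h | h
      · exact mem_union_left _ (hI h)
      · exact mem_union_right _ (mem_inter.2 ⟨ha, h⟩)
    · refine hgood.sparse T (fun a ha => ?_) hne
      rcases mem_union.1 (hT ha) with h | h
      · exact h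
      · exact absurd ⟨a, mem_inter.2 ⟨ha, h⟩⟩ hTK

/-- One step of the induction: select `K`, discard `X \ K`. -/
theorem HasGood.of_reduction {S X K : Finset V} {r : V → ℕ} (hXS : X ⊆ S) (hKX : K ⊆ X)
    (hrec : HasGood G (S \ X) (rest G K r))
    (hdeg : ∀ x ∈ K, (nb G (S \ X ∪ K) x).card < r x)
    (hsp : ∀ T ⊆ K, T.Nonempty → ∃ x ∈ T, (nb G (S \ X ∪ T) x).card ≤ 1)
    (hwt : ∑ y ∈ X, cwt G S r y + ∑ y ∈ S \ X, cwt G S r y ≤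
      K.card + ∑ y ∈ S \ X, cwt G (S \ X) (rest G K r) y) : HasGood G S r := by
  obtain ⟨I, hI, hgood, hle⟩ := hrec
  refine ⟨I ∪ K, union_subset (hI.trans sdiff_subset) (hKX.trans hXS),
    hgood.union hKX hI hdeg hsp, ?_⟩
  have hdis : Disjoint I K := by
    rw [disjoint_left]
    intro a ha hK
    exact (mem_sdiff.1 (hI ha)).2 (hKX hK)
  rw [card_union_of_disjoint hdis, ← sum_sdiff hXS]
  push_cast
  linarith

/-! ### Elementary properties of the weights -/

theorem wt_zero (d : ℕ) : wt 0 d = 0 := by simp [wt]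

theorem wt_one (d : ℕ) : wt 1 d = 2 / (3 * (d + 1)) := by simp [wt]

theorem wt_two {d : ℕ} (h : 1 ≤ d) : wt 2 d = 4 / (3 * (d + 1)) := by
  have : d ≠ 0 := by omega
  simp [wt, this]; norm_num

theorem wt_three {d : ℕ} (h : 2 ≤ d) : wt 3 d = 2 / (d + 1) := by
  have h0 : d ≠ 0 := by omega
  have h1 : d ≠ 1 := by omega
  simp only [wt, h0, h1, and_false, if_false]
  push_cast
  field_simp

theorem wt_two_zero : wt 2 0 = 1 := by simp [wt]

theorem wt_three_zero : wt 3 0 = 1 := by simp [wt]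

theorem wt_three_one : wt 3 1 = 2 / 3 := by simp [wt]

theorem wt_nonneg (r d : ℕ) : 0 ≤ wt r d := by
  unfold wt; split_ifs <;> positivity

theorem div_le_div_three {c : ℝ} (hc : 0 ≤ c) {d e : ℕ} (h : d ≤ e) :
    c / (3 * ((e : ℝ) + 1)) ≤ c / (3 * ((d : ℝ) + 1)) := by
  have : (d : ℝ) ≤ e := by exact_mod_cast h
  gcongr

theorem wt_anti {r : ℕ} (hr : r ≤ 3) {d e : ℕ} (h : d ≤ e) : wt r e ≤ wt r d := by
  have hde : (d : ℝ) ≤ e := by exact_mod_cast h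
  interval_cases r
  · simp [wt_zero]
  · rw [wt_one, wt_one]; exact div_le_div_three (by norm_num) h
  · rcases Nat.eq_zero_or_pos e with he | he
    · obtain rfl : d = e := by omega
      rfl
    rw [wt_two he]
    rcases Nat.eq_zero_or_pos d with hd | hd
    · subst hd
      rw [wt_two_zero, div_le_one (by positivity)]
      have : (1 : ℝ) ≤ e := by exact_mod_cast he
      linarith
    · rw [wt_two hd]; exact div_le_div_three (by norm_num) h
  · rcases Nat.lt_or_ge e 2 with he | he
    · interval_cases e <;> interval_cases d <;>
        norm_num [wt_three_zero, wt_three_one]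
    rw [wt_three he]
    have h2 : (2 : ℝ) ≤ e := by exact_mod_cast he
    rcases Nat.lt_or_ge d 2 with hd | hd
    · have : 2 / ((e : ℝ) + 1) ≤ 2 / 3 := by
        gcongr; linarith
      interval_cases d
      · rw [wt_three_zero]; linarith
      · rw [wt_three_one]; exact this
    · rw [wt_three hd]; gcongr

theorem wt_le_one {r : ℕ} (hr : r ≤ 3) (d : ℕ) : wt r d ≤ 1 := by
  refine (wt_anti hr (Nat.zero_le d)).trans ?_
  interval_cases r <;> norm_num [wt_zero, wt_one, wt_two_zero, wt_three_zero]

theorem cwt_le_wt (S : Finset V) (r : V → ℕ) (y : V) :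
    cwt G S r y ≤ wt (r y) (nb G S y).card := by
  unfold cwt; split_ifs <;> linarith

/-! ### Reductions that change few capacities -/

theorem IsTight.cwt_eq {S : Finset V} {r : V → ℕ} {y : V} (h : IsTight G S r y) :
    cwt G S r y = 1 / 6 := by
  unfold cwt
  rw [if_pos h, h.1, h.2.1, wt_one]
  norm_num

/-- Shrinking the vertex set does not decrease the total corrected weight of the vertices whose
capacity is kept: a vertex that becomes tight is paid for by its own drop in degree, or by the
drop in degree of its neighbour of degree `2`. -/
theorem sum_cwt_le_sum_cwt {S S' : Finset V} {r r' : V → ℕ} (hS : S' ⊆ S) (hr : ∀ v, r v ≤ 3)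
    (hr' : ∀ v, r' v ≤ r v) :
    ∑ y ∈ S' with r' y = r y, cwt G S r y ≤ ∑ y ∈ S' with r' y = r y, cwt G S' r' y := by
  set R := S'.filter fun y => r' y = r y with hR
  -- `NT` are the new tight vertices; `A` those that reach degree `2` only in `S'`, where they gain
  -- `2 / 9 - 1 / 6 = 1 / 18`; `U` the vertices of capacity `3` that reach degree `2` only in `S'`,
  -- which gain `2 / 3 - 1 / 2 = 1 / 6` and have at most two tight neighbours
  set NT := R.filter fun y => IsTight G S' r' y ∧ ¬ IsTight G S r y with hNT
  set A := R.filter fun y => r y = 1 ∧ (nb G S' y).card = 2 ∧ 3 ≤ (nb G S y).card with hA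
  set U := R.filter fun y => r y = 3 ∧ (nb G S' y).card = 2 ∧ 3 ≤ (nb G S y).card with hU
  have hdle : ∀ y, (nb G S' y).card ≤ (nb G S y).card := fun y => card_le_card (nb_mono hS y)
  have hsub : NT ⊆ A ∪ U.biUnion fun u => nb G S' u := by
    intro y hy
    obtain ⟨hyR, ⟨h1, h2, u, hu, hu3, hu2, v, hv, huv⟩, hnt⟩ := mem_filter.1 hy
    have hry : r' y = r y := (mem_filter.1 hyR).2
    rcases Nat.lt_or_ge (nb G S y).card 3 with hlt | hge
    · refine mem_union_right _ (mem_biUnion.2 ⟨u, ?_, ?_⟩)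
      · have hru : r u = 3 := le_antisymm (hr u) (hu3 ▸ hr' u)
        refine mem_filter.2 ⟨mem_filter.2 ⟨(mem_nb.1 hu).1, by rw [hu3, hru]⟩, hru, hu2, ?_⟩
        by_contra hlt'
        have hy2 := hdle y
        have heq : nb G S y = nb G S' y :=
          (eq_of_subset_of_card_le (nb_mono hS y) (by omega)).symm
        refine hnt ⟨by omega, by omega, u, heq ▸ hu, hru, ?_, v, heq ▸ hv, huv⟩
        have := hdle u
        omega
      · rw [mem_nb] at hu ⊢
        exact ⟨(mem_filter.1 hyR).1, hu.2.symm⟩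
    · exact mem_union_left _ (mem_filter.2 ⟨hyR, by omega, h2, hge⟩)
  have hcard : NT.card ≤ A.card + U.card * 2 := by
    refine (card_le_card hsub).trans ((card_union_le _ _).trans (Nat.add_le_add_left ?_ _))
    refine card_biUnion_le_card_mul _ _ _ fun u hu => ?_
    exact (mem_filter.1 hu).2.2.1.le
  have hcardR : (NT.card : ℝ) ≤ A.card + U.card * 2 := by exact_mod_cast hcard
  rw [hNT, hA, hU, natCast_card_filter, natCast_card_filter, natCast_card_filter] at hcardR
  have hpt : ∀ y ∈ R, cwt G S r y +
      1 / 18 * ((if r y = 1 ∧ (nb G S' y).card = 2 ∧ 3 ≤ (nb G S y).card then (1 : ℝ) else 0) +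
        (if r y = 3 ∧ (nb G S' y).card = 2 ∧ 3 ≤ (nb G S y).card then (1 : ℝ) else 0) * 2) ≤
      cwt G S' r' y +
        1 / 18 * (if IsTight G S' r' y ∧ ¬ IsTight G S r y then (1 : ℝ) else 0) := by
    intro y hy
    have hry : r' y = r y := (mem_filter.1 hy).2
    have h1 : cwt G S r y ≤ wt (r y) (nb G S y).card - (if IsTight G S r y then 1 / 18 else 0) :=
      le_rfl
    have h2 : cwt G S' r' y =
        wt (r y) (nb G S' y).card - (if IsTight G S' r' y then 1 / 18 else 0) := by
      rw [cwt, hry]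
    have hmono := wt_anti (hr y) (hdle y)
    have h3 : (if IsTight G S' r' y then (1 / 18 : ℝ) else 0) ≤
        (if IsTight G S r y then 1 / 18 else 0) +
        1 / 18 * (if IsTight G S' r' y ∧ ¬ IsTight G S r y then (1 : ℝ) else 0) := by
      by_cases ha : IsTight G S' r' y <;> by_cases hb : IsTight G S r y <;> simp [ha, hb]
    have h4 : 1 / 18 *
        ((if r y = 1 ∧ (nb G S' y).card = 2 ∧ 3 ≤ (nb G S y).card then (1 : ℝ) else 0) +
        (if r y = 3 ∧ (nb G S' y).card = 2 ∧ 3 ≤ (nb G S y).card then (1 : ℝ) else 0) * 2) ≤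
        wt (r y) (nb G S' y).card - wt (r y) (nb G S y).card := by
      by_cases ha : r y = 1 ∧ (nb G S' y).card = 2 ∧ 3 ≤ (nb G S y).card
      · have hw := wt_anti (hr y) ha.2.2
        rw [ha.2.1]
        rw [ha.1] at hw ⊢
        rw [wt_one 3] at hw
        rw [wt_one 2]
        norm_num [ha] at hw ⊢
        linarith
      by_cases hb : r y = 3 ∧ (nb G S' y).card = 2 ∧ 3 ≤ (nb G S y).card
      · have hw := wt_anti (hr y) hb.2.2
        rw [hb.2.1]
        rw [hb.1] at hw ⊢
        rw [wt_three (d := 3) (by norm_num)] at hw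
        rw [wt_three le_rfl]
        norm_num [hb] at hw ⊢
        linarith
      · rw [if_neg ha, if_neg hb]; linarith
    linarith
  have := sum_le_sum hpt
  rw [sum_add_distrib, sum_add_distrib, ← mul_sum, ← mul_sum, sum_add_distrib, ← sum_mul] at this
  linarith

theorem rest_le (K : Finset V) (r : V → ℕ) (y : V) : rest G K r y ≤ r y := Nat.sub_le _ _

/-- A reduction that leaves all remaining capacities unchanged. -/
theorem HasGood.of_reduction_of_rest_eq {S X K : Finset V} {r : V → ℕ} (hr : ∀ v, r v ≤ 3)
    (hXS : X ⊆ S) (hKX : K ⊆ X) (hrec : HasGood G (S \ X) (rest G K r))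
    (hdeg : ∀ x ∈ K, (nb G (S \ X ∪ K) x).card < r x)
    (hsp : ∀ T ⊆ K, T.Nonempty → ∃ x ∈ T, (nb G (S \ X ∪ T) x).card ≤ 1)
    (hrest : ∀ y ∈ S \ X, rest G K r y = r y)
    (hwt : ∑ y ∈ X, cwt G S r y ≤ K.card) : HasGood G S r := by
  refine hrec.of_reduction hXS hKX hdeg hsp ?_
  have h := sum_cwt_le_sum_cwt (G := G) (S := S) (S' := S \ X) sdiff_subset hr (rest_le (G := G) K r)
  rw [filter_true_of_mem hrest] at h
  linarith

/-- A reduction that changes the remaining capacity of a single vertex `v`. -/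
theorem HasGood.of_reduction_of_rest_eq_off {S X K : Finset V} {r : V → ℕ} (hr : ∀ v, r v ≤ 3)
    (hXS : X ⊆ S) (hKX : K ⊆ X) (hrec : HasGood G (S \ X) (rest G K r))
    (hdeg : ∀ x ∈ K, (nb G (S \ X ∪ K) x).card < r x)
    (hsp : ∀ T ⊆ K, T.Nonempty → ∃ x ∈ T, (nb G (S \ X ∪ T) x).card ≤ 1)
    (v : V) (hv : v ∈ S \ X) (hne : rest G K r v ≠ r v)
    (hrest : ∀ y ∈ S \ X, y ≠ v → rest G K r y = r y)
    (hwt : ∑ y ∈ X, cwt G S r y + cwt G S r v ≤ K.card + cwt G (S \ X) (rest G K r) v) :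
    HasGood G S r := by
  refine hrec.of_reduction hXS hKX hdeg hsp ?_
  have h := sum_cwt_le_sum_cwt (G := G) (S := S) (S' := S \ X) sdiff_subset hr (rest_le (G := G) K r)
  have hf : (S \ X).filter (fun y => rest G K r y = r y) = (S \ X).erase v := by
    ext y
    simp only [mem_filter, mem_erase]
    refine ⟨fun ⟨h1, h2⟩ => ⟨?_, h1⟩, fun ⟨h1, h2⟩ => ⟨h2, hrest y h2 h1⟩⟩
    rintro rfl
    exact hne h2
  rw [hf] at h
  rw [← add_sum_erase _ _ hv, ← add_sum_erase _ (fun y => cwt G (S \ X) (rest G K r) y) hv]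
  linarith

/-- A lower bound for the corrected weight in terms of capacity and degree alone. -/
theorem wt_sub_le_cwt (S : Finset V) (r : V → ℕ) (y : V) :
    wt (r y) (nb G S y).card - (if r y = 1 ∧ (nb G S y).card = 2 then 1 / 18 else 0) ≤
      cwt G S r y := by
  unfold cwt
  by_cases h : IsTight G S r y
  · rw [if_pos h, if_pos ⟨h.1, h.2.1⟩]
  · rw [if_neg h]; split_ifs <;> norm_num

theorem nb_empty (v : V) : nb G ∅ v = ∅ := by simp [nb]

theorem rest_empty (r : V → ℕ) : rest G ∅ r = r := by
  funext y; simp [rest, nb_empty]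

theorem self_notMem_nb (S : Finset V) (v : V) : v ∉ nb G S v := by simp [nb]

/-- A vertex of capacity `0` can be discarded. -/
theorem HasGood.of_capacity_zero {S : Finset V} {r : V → ℕ} (hr : ∀ v, r v ≤ 3) {x : V}
    (hx : x ∈ S) (h0 : r x = 0) (hrec : HasGood G (S \ {x}) r) : HasGood G S r := by
  refine HasGood.of_reduction_of_rest_eq (X := {x}) (K := ∅) hr (by simpa) (by simp)
    (by rwa [rest_empty]) (by simp) ?_ (by simp [rest_empty]) ?_
  · intro T hT hne
    simp [subset_empty.1 hT] at hne
  · have := cwt_le_wt (G := G) S r x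
    rw [h0, wt_zero] at this
    simpa using this

/-! ### Reductions at vertices of small degree -/

/-- A vertex that loses a neighbour to the selection, and with it a unit of capacity, loses at most
`1 / 3` of weight; the subtracted term allows for its becoming tight. -/
theorem wt_le_retire {r d : ℕ} (hr1 : 1 ≤ r) (hr : r ≤ 3) (hd : 1 ≤ d) :
    wt r d ≤ 1 / 3 + (wt (r - 1) (d - 1) - if r - 1 = 1 ∧ d - 1 = 2 then 1 / 18 else 0) := by
  obtain ⟨d, rfl⟩ : ∃ e, d = e + 1 := ⟨d - 1, by omega⟩
  have h0 : (0 : ℝ) ≤ d := Nat.cast_nonneg d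
  rw [Nat.add_sub_cancel]
  interval_cases r
  · have := wt_anti (r := 1) (by norm_num) hd
    rw [wt_one 1] at this
    norm_num [wt_zero] at this ⊢
    linarith
  · rw [wt_two hd, wt_one]
    push_cast
    by_cases h2 : d = 2
    · subst h2; norm_num
    · rw [if_neg (by omega), sub_zero, ← sub_le_iff_le_add, div_sub_div _ _ (by positivity)
        (by positivity), div_le_div_iff₀ (by positivity) (by norm_num)]
      nlinarith
  · rcases Nat.lt_or_ge d 1 with h | h
    · obtain rfl : d = 0 := by omega
      norm_num [wt_three_one, wt_two_zero]
    · rw [wt_three (d := d + 1) (by omega), wt_two h]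
      push_cast
      rw [if_neg (by norm_num), sub_zero, ← sub_le_iff_le_add, div_sub_div _ _ (by positivity)
        (by positivity), div_le_div_iff₀ (by positivity) (by norm_num)]
      nlinarith

/-- A vertex of capacity at least `2` that loses one neighbour to the selection and another one by
deletion loses at most `1 / 6` of weight. -/
theorem wt_le_ear {r d : ℕ} (hr1 : 2 ≤ r) (hr : r ≤ 3) (hd : 2 ≤ d) :
    wt r d ≤ 1 / 6 + (wt (r - 1) (d - 2) - if r - 1 = 1 ∧ d - 2 = 2 then 1 / 18 else 0) := by
  obtain ⟨d, rfl⟩ : ∃ e, d = e + 2 := ⟨d - 2, by omega⟩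
  have h0 : (0 : ℝ) ≤ d := Nat.cast_nonneg d
  rw [Nat.add_sub_cancel]
  interval_cases r
  · rw [wt_two (by omega), wt_one]
    push_cast
    by_cases h2 : d = 2
    · subst h2; norm_num
    · rw [if_neg (by omega), sub_zero, ← sub_le_iff_le_add, div_sub_div _ _ (by positivity)
        (by positivity), div_le_div_iff₀ (by positivity) (by norm_num)]
      nlinarith
  · rcases Nat.lt_or_ge d 1 with h | h
    · obtain rfl : d = 0 := by omega
      norm_num [wt_three, wt_two_zero]
    · rw [wt_three (d := d + 2) (by omega), wt_two h]
      push_cast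
      rw [if_neg (by norm_num), sub_zero, ← sub_le_iff_le_add, div_sub_div _ _ (by positivity)
        (by positivity), div_le_div_iff₀ (by positivity) (by norm_num)]
      nlinarith

theorem rest_le_three {r : V → ℕ} (hr : ∀ v, r v ≤ 3) (K : Finset V) (v : V) :
    rest G K r v ≤ 3 := (rest_le K r v).trans (hr v)

theorem rest_eq_self {K : Finset V} {r : V → ℕ} {y : V} (h : ∀ x ∈ K, ¬ G.Adj y x) :
    rest G K r y = r y := by
  have : nb G K y = ∅ := filter_false_of_mem h
  simp [rest, this]

theorem nb_singleton_of_adj {x y : V} (h : G.Adj y x) : nb G {x} y = {x} := by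
  simp [nb, filter_singleton, h]

/-- A vertex of capacity `3` with a single neighbour `y` can be selected, at the expense of one
unit of the capacity of `y`. -/
theorem HasGood.of_pendant {S : Finset V} {r : V → ℕ} (hr : ∀ v, r v ≤ 3)
    (hpos : ∀ v ∈ S, 1 ≤ r v)
    (ih : ∀ S' ⊂ S, ∀ r' : V → ℕ, (∀ v, r' v ≤ 3) → HasGood G S' r')
    {u y : V} (hu : u ∈ S) (hu3 : r u = 3) (hy : nb G S u = {y}) : HasGood G S r := by
  have hy' : y ∈ S ∧ G.Adj u y := mem_nb.1 (hy ▸ mem_singleton_self y)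
  have hyu : y ≠ u := hy'.2.ne'
  have hXS : ({u} : Finset V) ⊆ S := by simpa
  have hyS : y ∈ S \ {u} := by simp [hy'.1, hyu]
  have hnb : nb G {u} y = {u} := nb_singleton_of_adj hy'.2.symm
  have hrest : rest G {u} r y = r y - 1 := by simp [rest, hnb]
  have hd : (nb G (S \ {u}) y).card = (nb G S y).card - 1 := by
    have := card_nb_sdiff_add (G := G) hXS y
    rw [hnb, card_singleton] at this
    omega
  have hd1 : 1 ≤ (nb G S y).card := card_pos.2 ⟨u, mem_nb.2 ⟨hu, hy'.2.symm⟩⟩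
  have hr1 := hpos y hy'.1
  refine HasGood.of_reduction_of_rest_eq_off (X := {u}) (K := {u}) hr hXS Subset.rfl
    (ih _ (sdiff_ssubset hXS (by simp)) _ (rest_le_three hr _)) ?_ ?_ y hyS (by omega) ?_ ?_
  · intro x hx
    rw [mem_singleton.1 hx, sdiff_union_of_subset hXS, hy, hu3]
    norm_num
  · intro T hT hne
    obtain rfl := (subset_singleton_iff.1 hT).resolve_left hne.ne_empty
    exact ⟨u, mem_singleton_self u, by rw [sdiff_union_of_subset hXS, hy, card_singleton]⟩
  · intro z hz hzy
    refine rest_eq_self fun x hx hadj => hzy ?_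
    rw [mem_singleton.1 hx] at hadj
    have : z ∈ nb G S u := mem_nb.2 ⟨(mem_sdiff.1 hz).1, hadj.symm⟩
    rwa [hy, mem_singleton] at this
  · have h1 := cwt_le_wt (G := G) S r u
    rw [hu3, hy, card_singleton, wt_three_one] at h1
    have h2 := cwt_le_wt (G := G) S r y
    have h3 := wt_sub_le_cwt (G := G) (S \ {u}) (rest G {u} r) y
    rw [hrest, hd] at h3
    have h4 := wt_le_retire hr1 (hr y) hd1
    simp only [sum_singleton, card_singleton, Nat.cast_one]
    linarith

/-- A vertex of capacity `1` with a single neighbour `u` can be selected, discarding `u`. -/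
theorem HasGood.of_capacity_one_degree_one {S : Finset V} {r : V → ℕ} (hr : ∀ v, r v ≤ 3)
    (ih : ∀ S' ⊂ S, ∀ r' : V → ℕ, (∀ v, r' v ≤ 3) → HasGood G S' r')
    {y u : V} (hy : y ∈ S) (hy1 : r y = 1) (hu : nb G S y = {u}) : HasGood G S r := by
  have hu' : u ∈ S ∧ G.Adj y u := mem_nb.1 (hu ▸ mem_singleton_self u)
  have hXS : ({y, u} : Finset V) ⊆ S := by simp [insert_subset_iff, hy, hu'.1]
  have hempty : nb G (S \ {y, u} ∪ {y}) y = ∅ := by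
    refine filter_false_of_mem fun z hz hadj => ?_
    rcases mem_union.1 hz with hz | hz
    · have : z ∈ nb G S y := mem_nb.2 ⟨(mem_sdiff.1 hz).1, hadj⟩
      rw [hu, mem_singleton] at this
      simp [this] at hz
    · exact G.irrefl (mem_singleton.1 hz ▸ hadj)
  refine HasGood.of_reduction_of_rest_eq (X := {y, u}) (K := {y}) hr hXS (by simp)
    (ih _ (sdiff_ssubset hXS (by simp)) _ (rest_le_three hr _)) ?_ ?_ ?_ ?_
  · intro x hx
    rw [mem_singleton.1 hx, hempty, hy1]
    norm_num
  · intro T hT hne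
    obtain rfl := (subset_singleton_iff.1 hT).resolve_left hne.ne_empty
    exact ⟨y, mem_singleton_self y, by rw [hempty]; simp⟩
  · intro z hz
    refine rest_eq_self fun x hx hadj => ?_
    rw [mem_singleton.1 hx] at hadj
    have : z ∈ nb G S y := mem_nb.2 ⟨(mem_sdiff.1 hz).1, hadj.symm⟩
    rw [hu, mem_singleton] at this
    simp [this] at hz
  · have h1 := cwt_le_wt (G := G) S r y
    rw [hy1, hu, card_singleton, wt_one] at h1
    have h2 := cwt_le_wt (G := G) S r u
    have h3 : wt (r u) (nb G S u).card ≤ wt (r u) 1 :=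
      wt_anti (hr u) (card_pos.2 ⟨y, mem_nb.2 ⟨hy, hu'.2.symm⟩⟩)
    have h4 : wt (r u) 1 ≤ 2 / 3 := by
      have := hr u
      interval_cases r u <;> norm_num [wt_zero, wt_one, wt_two, wt_three_one]
    rw [sum_pair hu'.2.ne, card_singleton]
    norm_num at h1 ⊢
    linarith

/-- An ear `u` on the edge `y v`, where `y` has capacity `1`: select `u` and discard `y`. Here `u`
weighs `2 / 3`, and `y` and the loss at `v` account for at most `1 / 6` each. -/
theorem HasGood.of_ear {S : Finset V} {r : V → ℕ} (hr : ∀ v, r v ≤ 3)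
    (hpos : ∀ v ∈ S, 1 ≤ r v)
    (ih : ∀ S' ⊂ S, ∀ r' : V → ℕ, (∀ v, r' v ≤ 3) → HasGood G S' r')
    {y u v : V} (hy : y ∈ S) (hy1 : r y = 1) (hu : u ∈ S) (hu3 : r u = 3)
    (hnu : nb G S u = {y, v}) (hyv : G.Adj y v) : HasGood G S r := by
  have hyu : G.Adj u y := (mem_nb.1 (by rw [hnu]; simp : y ∈ nb G S u)).2
  obtain ⟨hv, huv⟩ := mem_nb.1 (by rw [hnu]; simp : v ∈ nb G S u)
  have hXS : ({y, u} : Finset V) ⊆ S := by simp [insert_subset_iff, hy, hu]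
  have hvS : v ∈ S \ {y, u} := by simp [hv, hyv.ne', huv.ne']
  have hnb : nb G {u} v = {u} := nb_singleton_of_adj huv.symm
  have hrest : rest G {u} r v = r v - 1 := by simp [rest, hnb]
  have hX2 : (nb G {y, u} v).card = 2 := by
    have : nb G {y, u} v = {y, u} := by
      refine filter_true_of_mem fun z hz => ?_
      rcases mem_insert.1 hz with rfl | hz
      · exact hyv.symm
      · rw [mem_singleton.1 hz]; exact huv.symm
    rw [this, card_pair hyu.ne']
  have hd := card_nb_sdiff_add (G := G) hXS v
  have hsub : ∀ T ⊆ ({u} : Finset V), nb G (S \ {y, u} ∪ T) u ⊆ {v} := by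
    intro T hT z hz
    obtain ⟨hz, hadj⟩ := mem_nb.1 hz
    have hzS : z ∈ S := by
      rcases mem_union.1 hz with hz | hz
      · exact (mem_sdiff.1 hz).1
      · rw [mem_singleton.1 (hT hz)]; exact hu
    have : z ∈ nb G S u := mem_nb.2 ⟨hzS, hadj⟩
    rw [hnu, mem_insert] at this
    refine this.resolve_left ?_
    rintro rfl
    rcases mem_union.1 hz with hz | hz
    · simp at hz
    · exact hyu.ne' (mem_singleton.1 (hT hz))
  have hr1 := hpos v hv
  refine HasGood.of_reduction_of_rest_eq_off (X := {y, u}) (K := {u}) hr hXS (by simp)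
    (ih _ (sdiff_ssubset hXS (by simp)) _ (rest_le_three hr _)) ?_ ?_ v hvS (by omega) ?_ ?_
  · intro x hx
    rw [mem_singleton.1 hx, hu3]
    exact (card_le_card (hsub _ Subset.rfl)).trans_lt (by simp)
  · intro T hT hne
    obtain rfl := (subset_singleton_iff.1 hT).resolve_left hne.ne_empty
    exact ⟨u, mem_singleton_self u, (card_le_card (hsub _ hT)).trans (by simp)⟩
  · intro z hz hzv
    refine rest_eq_self fun x hx hadj => ?_
    rw [mem_singleton.1 hx] at hadj
    have : z ∈ nb G S u := mem_nb.2 ⟨(mem_sdiff.1 hz).1, hadj.symm⟩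
    rw [hnu] at this
    simp only [mem_insert, mem_singleton] at this
    rcases this with rfl | rfl
    · simp at hz
    · exact hzv rfl
  · -- a vertex of capacity `1` on an ear weighs at most `1 / 6`: it is tight if its degree is `2`
    have hone : ∀ a b, a ∈ S → b ∈ S → G.Adj a b → G.Adj u a → G.Adj u b →
        (nb G S u).card = 2 → r a = 1 → cwt G S r a ≤ 1 / 6 := by
      intro a b ha hb hab hua hub h2 ha1
      have hpair : ({u, b} : Finset V) ⊆ nb G S a := by
        intro z hz
        rcases mem_insert.1 hz with rfl | hz
        · exact mem_nb.2 ⟨hu, hua.symm⟩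
        · rw [mem_singleton.1 hz]; exact mem_nb.2 ⟨hb, hab⟩
      have hc := card_le_card hpair
      rw [card_pair hub.ne] at hc
      rcases hc.eq_or_lt with hc | hc
      · refine (IsTight.cwt_eq ?_).le
        exact ⟨ha1, hc.symm, u, hpair (by simp), hu3, h2, b, hpair (by simp), hub⟩
      · refine (cwt_le_wt S r a).trans ((wt_anti (hr a) hc).trans ?_)
        rw [ha1, wt_one]; norm_num
    have hu2 : (nb G S u).card = 2 := by rw [hnu, card_pair hyv.ne]
    have h1 := hone y v hy hv hyv hyu huv hu2 hy1
    have h2 := cwt_le_wt (G := G) S r u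
    rw [hu3, hu2, wt_three le_rfl] at h2
    have h3 := wt_sub_le_cwt (G := G) (S \ {y, u}) (rest G {u} r) v
    have hdv : (nb G (S \ {y, u}) v).card = (nb G S v).card - 2 := by omega
    have h4 : cwt G S r v ≤ 1 / 6 + cwt G (S \ {y, u}) (rest G {u} r) v := by
      rcases hr1.eq_or_lt with h | h
      · have h5 := hone v y hv hy hyv.symm huv hyu hu2 h.symm
        rw [hrest, ← h, wt_zero] at h3
        norm_num at h3
        linarith
      · rw [hrest, hdv] at h3
        have := wt_le_ear h (hr v) (d := (nb G S v).card) (by omega)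
        have := cwt_le_wt (G := G) S r v
        linarith
    rw [sum_pair hyu.ne', card_singleton]
    norm_num at h2 ⊢
    linarith

/-- Two adjacent vertices `y`, `y'` of capacity `1` and degree `2` with a common neighbour of
capacity `3` and degree `3`: select `y`. -/
theorem HasGood.of_triangle {S : Finset V} {r : V → ℕ} (hr : ∀ v, r v ≤ 3)
    (ih : ∀ S' ⊂ S, ∀ r' : V → ℕ, (∀ v, r' v ≤ 3) → HasGood G S' r')
    {y y' u : V} (hy : y ∈ S) (hy1 : r y = 1) (hy1' : r y' = 1)
    (hny : nb G S y = {u, y'}) (hny' : (nb G S y').card = 2) (huy' : u ≠ y') (hu3 : r u = 3)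
    (hnu : (nb G S u).card = 3) : HasGood G S r := by
  obtain ⟨hu, hyu⟩ := mem_nb.1 (by rw [hny]; simp : u ∈ nb G S y)
  obtain ⟨hy', hyy'⟩ := mem_nb.1 (by rw [hny]; simp : y' ∈ nb G S y)
  have hXS : ({y, u, y'} : Finset V) ⊆ S := by simp [insert_subset_iff, hy, hu, hy']
  have hempty : nb G (S \ {y, u, y'} ∪ {y}) y = ∅ := by
    refine filter_false_of_mem fun z hz hadj => ?_
    rcases mem_union.1 hz with hz | hz
    · have : z ∈ nb G S y := mem_nb.2 ⟨(mem_sdiff.1 hz).1, hadj⟩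
      rw [hny] at this
      exact (mem_sdiff.1 hz).2 (mem_insert_of_mem this)
    · exact G.irrefl (mem_singleton.1 hz ▸ hadj)
  refine HasGood.of_reduction_of_rest_eq (X := {y, u, y'}) (K := {y}) hr hXS (by simp)
    (ih _ (sdiff_ssubset hXS (by simp)) _ (rest_le_three hr _)) ?_ ?_ ?_ ?_
  · intro x hx
    rw [mem_singleton.1 hx, hempty, hy1]
    norm_num
  · intro T hT hne
    obtain rfl := (subset_singleton_iff.1 hT).resolve_left hne.ne_empty
    exact ⟨y, mem_singleton_self y, by rw [hempty]; simp⟩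
  · intro z hz
    refine rest_eq_self fun x hx hadj => ?_
    rw [mem_singleton.1 hx] at hadj
    have : z ∈ nb G S y := mem_nb.2 ⟨(mem_sdiff.1 hz).1, hadj.symm⟩
    rw [hny] at this
    exact (mem_sdiff.1 hz).2 (mem_insert_of_mem this)
  · have h1 := cwt_le_wt (G := G) S r y
    rw [hy1, hny, card_pair huy', wt_one] at h1
    have h2 := cwt_le_wt (G := G) S r y'
    rw [hy1', hny', wt_one] at h2
    have h3 := cwt_le_wt (G := G) S r u
    rw [hu3, hnu, wt_three (by norm_num)] at h3
    rw [sum_insert (by simp [hyu.ne, hyy'.ne]), sum_pair huy', card_singleton]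
    norm_num at h1 h2 h3 ⊢
    linarith

/-! ### Four-cycles and graphs without deletable vertices -/

/-- A four-cycle `y u₁ v u₂` in which only `v`, of capacity and degree `3`, has a further
neighbour: select `u₁` and `u₂` and discard `y`. -/
theorem HasGood.of_fourCycle_of_three {S : Finset V} {r : V → ℕ} (hr : ∀ v, r v ≤ 3)
    (ih : ∀ S' ⊂ S, ∀ r' : V → ℕ, (∀ v, r' v ≤ 3) → HasGood G S' r')
    {y u₁ u₂ v : V} (hy : y ∈ S) (hv : v ∈ S) (hy2 : r y = 2) (h12 : u₁ ≠ u₂) (hyv : y ≠ v)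
    (hny : nb G S y = {u₁, u₂})
    (h1 : r u₁ = 3) (h2 : r u₂ = 3) (hn1 : nb G S u₁ = {y, v}) (hn2 : nb G S u₂ = {y, v})
    (hv3 : r v = 3) (hnv : (nb G S v).card = 3) : HasGood G S r := by
  obtain ⟨hu1, hyu1⟩ := mem_nb.1 (by rw [hny]; simp : u₁ ∈ nb G S y)
  obtain ⟨hu2, hyu2⟩ := mem_nb.1 (by rw [hny]; simp : u₂ ∈ nb G S y)
  have hv1 : G.Adj u₁ v := (mem_nb.1 (by rw [hn1]; simp : v ∈ nb G S u₁)).2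
  have hv2 : G.Adj u₂ v := (mem_nb.1 (by rw [hn2]; simp : v ∈ nb G S u₂)).2
  have hXS : ({y, u₁, u₂} : Finset V) ⊆ S := by simp [insert_subset_iff, hy, hu1, hu2]
  have hvS : v ∈ S \ {y, u₁, u₂} := by simp [hv, hyv.symm, hv1.ne', hv2.ne']
  have hnyv : ¬ G.Adj v y := fun h => by
    have : v ∈ nb G S y := mem_nb.2 ⟨hv, h.symm⟩
    rw [hny] at this
    rcases mem_insert.1 this with h | h
    · exact hv1.ne' h
    · exact hv2.ne' (mem_singleton.1 h)
  have hnb : nb G {u₁, u₂} v = {u₁, u₂} := by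
    refine filter_true_of_mem fun z hz => ?_
    rcases mem_insert.1 hz with rfl | hz
    · exact hv1.symm
    · rw [mem_singleton.1 hz]; exact hv2.symm
  have hnbX : nb G {y, u₁, u₂} v = {u₁, u₂} := by
    rw [nb, filter_insert, if_neg hnyv]; exact hnb
  have hrest : rest G {u₁, u₂} r v = 1 := by rw [rest, hnb, card_pair h12, hv3]
  have hd : (nb G (S \ {y, u₁, u₂}) v).card = 1 := by
    have := card_nb_sdiff_add (G := G) hXS v
    rw [hnbX, card_pair h12, hnv] at this
    omega
  have hKn : ∀ x ∈ ({u₁, u₂} : Finset V), nb G S x = {y, v} := by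
    intro x hx
    rcases mem_insert.1 hx with rfl | hx
    · exact hn1
    · rw [mem_singleton.1 hx]; exact hn2
  have hsub : ∀ T ⊆ ({u₁, u₂} : Finset V), ∀ x ∈ ({u₁, u₂} : Finset V),
      nb G (S \ {y, u₁, u₂} ∪ T) x ⊆ {v} := by
    intro T hT x hx z hz
    obtain ⟨hz, hadj⟩ := mem_nb.1 hz
    have hzS : z ∈ S := by
      rcases mem_union.1 hz with hz | hz
      · exact (mem_sdiff.1 hz).1
      · exact hXS (mem_insert_of_mem (hT hz))
    have : z ∈ nb G S x := mem_nb.2 ⟨hzS, hadj⟩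
    rw [hKn x hx, mem_insert] at this
    refine this.resolve_left ?_
    rintro rfl
    rcases mem_union.1 hz with hz | hz
    · simp at hz
    · rcases mem_insert.1 (hT hz) with h | h
      · exact hyu1.ne h
      · exact hyu2.ne (mem_singleton.1 h)
  refine HasGood.of_reduction_of_rest_eq_off (X := {y, u₁, u₂}) (K := {u₁, u₂}) hr hXS (by simp)
    (ih _ (sdiff_ssubset hXS (by simp)) _ (rest_le_three hr _)) ?_ ?_ v hvS (by omega) ?_ ?_
  · intro x hx
    have : r x = 3 := by
      rcases mem_insert.1 hx with rfl | hx
      · exact h1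
      · rw [mem_singleton.1 hx]; exact h2
    rw [this]
    exact (card_le_card (hsub _ Subset.rfl x hx)).trans_lt (by simp)
  · intro T hT hne
    obtain ⟨x, hx⟩ := hne
    exact ⟨x, hx, (card_le_card (hsub _ hT x (hT hx))).trans (by simp)⟩
  · intro z hz hzv
    refine rest_eq_self fun x hx hadj => ?_
    have : z ∈ nb G S x := mem_nb.2 ⟨(mem_sdiff.1 hz).1, hadj.symm⟩
    rw [hKn x hx] at this
    simp only [mem_insert, mem_singleton] at this
    rcases this with rfl | rfl
    · simp at hz
    · exact hzv rfl
  · have e1 := cwt_le_wt (G := G) S r y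
    rw [hy2, hny, card_pair h12, wt_two (by norm_num)] at e1
    have e2 := cwt_le_wt (G := G) S r u₁
    rw [h1, hn1, card_pair hyv, wt_three le_rfl] at e2
    have e3 := cwt_le_wt (G := G) S r u₂
    rw [h2, hn2, card_pair hyv, wt_three le_rfl] at e3
    have e4 := cwt_le_wt (G := G) S r v
    rw [hv3, hnv, wt_three (by norm_num)] at e4
    have e5 := wt_sub_le_cwt (G := G) (S \ {y, u₁, u₂}) (rest G {u₁, u₂} r) v
    rw [hrest, hd, wt_one] at e5
    rw [sum_insert (by simp [hyu1.ne, hyu2.ne]), sum_pair h12, card_pair h12]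
    norm_num at e1 e2 e3 e4 e5 ⊢
    linarith

/-- A component that is a four-cycle `y u₁ v u₂` with `y`, `v` of capacity `2` and `u₁`, `u₂` of
capacity `3`: select the path `y u₂ v`. -/
theorem HasGood.of_fourCycle_of_two {S : Finset V} {r : V → ℕ} (hr : ∀ v, r v ≤ 3)
    (ih : ∀ S' ⊂ S, ∀ r' : V → ℕ, (∀ v, r' v ≤ 3) → HasGood G S' r')
    {y u₁ u₂ v : V} (hy : y ∈ S) (hv : v ∈ S) (hy2 : r y = 2) (h12 : u₁ ≠ u₂) (hyv : y ≠ v)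
    (hny : nb G S y = {u₁, u₂})
    (h1 : r u₁ = 3) (h2 : r u₂ = 3) (hn1 : nb G S u₁ = {y, v}) (hn2 : nb G S u₂ = {y, v})
    (hv2 : r v = 2) (hnv : nb G S v = {u₁, u₂}) : HasGood G S r := by
  obtain ⟨hu1, hyu1⟩ := mem_nb.1 (by rw [hny]; simp : u₁ ∈ nb G S y)
  obtain ⟨hu2, hyu2⟩ := mem_nb.1 (by rw [hny]; simp : u₂ ∈ nb G S y)
  have hvu1 : G.Adj v u₁ := (mem_nb.1 (by rw [hnv]; simp : u₁ ∈ nb G S v)).2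
  have hvu2 : G.Adj v u₂ := (mem_nb.1 (by rw [hnv]; simp : u₂ ∈ nb G S v)).2
  set X : Finset V := {y, u₁, u₂, v} with hX
  have hXS : X ⊆ S := by simp [hX, insert_subset_iff, hy, hu1, hu2, hv]
  have hKX : ({y, u₂, v} : Finset V) ⊆ X := by simp [hX, insert_subset_iff]
  have hKS := hKX.trans hXS
  have hclosed : ∀ x ∈ X, nb G S x ⊆ X := by
    intro x hx
    simp only [hX, mem_insert, mem_singleton] at hx
    rcases hx with rfl | rfl | rfl | rfl
    · rw [hny]; simp [hX, insert_subset_iff]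
    · rw [hn1]; simp [hX, insert_subset_iff]
    · rw [hn2]; simp [hX, insert_subset_iff]
    · rw [hnv]; simp [hX, insert_subset_iff]
  have hsub : ∀ T ⊆ ({y, u₂, v} : Finset V), ∀ x ∈ X,
      nb G (S \ X ∪ T) x ⊆ nb G S x ∩ T := by
    intro T hT x hx z hz
    obtain ⟨hz, hadj⟩ := mem_nb.1 hz
    have hzS : z ∈ S := by
      rcases mem_union.1 hz with hz | hz
      · exact (mem_sdiff.1 hz).1
      · exact hKS (hT hz)
    have hmem : z ∈ nb G S x := mem_nb.2 ⟨hzS, hadj⟩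
    refine mem_inter.2 ⟨hmem, ?_⟩
    rcases mem_union.1 hz with hz | hz
    · exact absurd (hclosed x hx hmem) (mem_sdiff.1 hz).2
    · exact hz
  have hu1K : u₁ ∉ ({y, u₂, v} : Finset V) := by simp [hyu1.ne', h12, hvu1.ne']
  have hend : ∀ T ⊆ ({y, u₂, v} : Finset V), ∀ x ∈ X, nb G S x = {u₁, u₂} →
      (nb G (S \ X ∪ T) x).card ≤ 1 := by
    intro T hT x hx hnx
    have : nb G (S \ X ∪ T) x ⊆ {u₂} := by
      intro z hz
      obtain ⟨hz1, hz2⟩ := mem_inter.1 (hsub T hT x hx hz)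
      rw [hnx, mem_insert] at hz1
      refine hz1.resolve_left ?_
      rintro rfl
      exact hu1K (hT hz2)
    exact (card_le_card this).trans (by simp)
  have hyX : y ∈ X := by simp [hX]
  have hvX : v ∈ X := by simp [hX]
  have hu2X : u₂ ∈ X := by simp [hX]
  refine HasGood.of_reduction_of_rest_eq (X := X) (K := {y, u₂, v}) hr hXS hKX
    (ih _ (sdiff_ssubset hXS ⟨y, hyX⟩) _ (rest_le_three hr _)) ?_ ?_ ?_ ?_
  · intro x hx
    simp only [mem_insert, mem_singleton] at hx
    rcases hx with rfl | rfl | rfl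
    · rw [hy2]; exact Nat.lt_succ_of_le (hend _ Subset.rfl _ hyX hny)
    · rw [h2]
      have := card_le_card ((hsub _ Subset.rfl _ hu2X).trans inter_subset_left)
      rw [hn2, card_pair hyv] at this
      omega
    · rw [hv2]; exact Nat.lt_succ_of_le (hend _ Subset.rfl _ hvX hnv)
  · intro T hT hne
    by_cases hyT : y ∈ T
    · exact ⟨y, hyT, hend T hT y hyX hny⟩
    by_cases hvT : v ∈ T
    · exact ⟨v, hvT, hend T hT v hvX hnv⟩
    obtain ⟨x, hx⟩ := hne
    refine ⟨x, hx, ?_⟩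
    have hx2 : x = u₂ := by
      have := hT hx
      simp only [mem_insert, mem_singleton] at this
      rcases this with rfl | h | rfl
      · exact absurd hx hyT
      · exact h
      · exact absurd hx hvT
    have : nb G (S \ X ∪ T) x = ∅ := by
      rw [← subset_empty]
      intro z hz
      obtain ⟨hz1, hz2⟩ := mem_inter.1 (hsub T hT x (hx2 ▸ hu2X) hz)
      rw [hx2, hn2] at hz1
      simp only [mem_insert, mem_singleton] at hz1
      rcases hz1 with rfl | rfl
      · exact absurd hz2 hyT
      · exact absurd hz2 hvT
    rw [this]; simp
  · intro z hz
    refine rest_eq_self fun x hx hadj => ?_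
    exact (mem_sdiff.1 hz).2 (hclosed x (hKX hx) (mem_nb.2 ⟨(mem_sdiff.1 hz).1, hadj.symm⟩))
  · have e1 := cwt_le_wt (G := G) S r y
    rw [hy2, hny, card_pair h12, wt_two (by norm_num)] at e1
    have e2 := cwt_le_wt (G := G) S r u₁
    rw [h1, hn1, card_pair hyv, wt_three le_rfl] at e2
    have e3 := cwt_le_wt (G := G) S r u₂
    rw [h2, hn2, card_pair hyv, wt_three le_rfl] at e3
    have e4 := cwt_le_wt (G := G) S r v
    rw [hv2, hnv, card_pair h12, wt_two (by norm_num)] at e4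
    rw [hX, sum_insert (by simp [hyu1.ne, hyu2.ne, hyv]), sum_insert (by simp [h12, hvu1.ne']),
      sum_pair hvu2.ne', card_insert_of_notMem (by simp [hyu2.ne, hyv]), card_pair hvu2.ne']
    norm_num at e1 e2 e3 e4 ⊢
    linarith

/-- If every degree is below the capacity, then it is enough to break the cycles, which are
components of `S`: a cycle on `m ≥ 3` vertices weighs `(2 / 3) m ≤ m - 1`. -/
theorem HasGood.of_card_lt {S : Finset V} {r : V → ℕ} (hr : ∀ v, r v ≤ 3)
    (ih : ∀ S' ⊂ S, ∀ r' : V → ℕ, (∀ v, r' v ≤ 3) → HasGood G S' r')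
    (hlt : ∀ v ∈ S, (nb G S v).card < r v) : HasGood G S r := by
  by_cases hsp : ∀ T ⊆ S, T.Nonempty → ∃ x ∈ T, (nb G T x).card ≤ 1
  · refine ⟨S, Subset.rfl, ⟨hlt, hsp⟩, ?_⟩
    calc ∑ y ∈ S, cwt G S r y ≤ ∑ y ∈ S, (1 : ℝ) :=
          sum_le_sum fun y _ => (cwt_le_wt S r y).trans (wt_le_one (hr y) _)
      _ = S.card := by simp
  push Not at hsp
  obtain ⟨T₀, hT₀⟩ := hsp
  -- a smallest subset of minimum degree at least `2`
  obtain ⟨T, hT, hmin⟩ := exists_min_image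
    (S.powerset.filter fun T => T.Nonempty ∧ ∀ x ∈ T, 1 < (nb G T x).card) card
    ⟨T₀, mem_filter.2 ⟨mem_powerset.2 hT₀.1, hT₀.2⟩⟩
  obtain ⟨hTS, hne, hT2⟩ := mem_filter.1 hT
  rw [mem_powerset] at hTS
  have hmin' : ∀ T' ⊂ T, T'.Nonempty → ∃ x ∈ T', (nb G T' x).card ≤ 1 := by
    intro T' hT' hne'
    by_contra! hcon
    have := hmin T' (mem_filter.2 ⟨mem_powerset.2 (hT'.1.trans hTS), hne', hcon⟩)
    exact absurd (card_lt_card hT') (by omega)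
  -- all degrees in `S` are below the capacities, hence at most `2`, so `T` induces a cycle that is
  -- a component of `S`; one vertex of it is discarded
  have hdata : ∀ x ∈ T, r x = 3 ∧ (nb G S x).card = 2 ∧ nb G S x = nb G T x := by
    intro x hx
    have h1 := hT2 x hx
    have h2 := hlt x (hTS hx)
    have h3 := hr x
    have h4 := card_le_card (nb_mono (G := G) hTS x)
    exact ⟨by omega, by omega, (eq_of_subset_of_card_le (nb_mono hTS x) (by omega)).symm⟩
  obtain ⟨x₀, hx₀⟩ := hne
  have hclosed : ∀ x ∈ T, ∀ z ∈ S, G.Adj x z → z ∈ T := by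
    intro x hx z hz hadj
    have : z ∈ nb G S x := mem_nb.2 ⟨hz, hadj⟩
    rw [(hdata x hx).2.2] at this
    exact (mem_nb.1 this).1
  have hsub : ∀ T' ⊆ T.erase x₀, ∀ x ∈ T, nb G (S \ T ∪ T') x ⊆ nb G T' x := by
    intro T' hT' x hx z hz
    obtain ⟨hz, hadj⟩ := mem_nb.1 hz
    refine mem_nb.2 ⟨?_, hadj⟩
    rcases mem_union.1 hz with hz | hz
    · exact absurd (hclosed x hx z (mem_sdiff.1 hz).1 hadj) (mem_sdiff.1 hz).2
    · exact hz
  refine HasGood.of_reduction_of_rest_eq (X := T) (K := T.erase x₀) hr hTS (erase_subset _ _)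
    (ih _ (sdiff_ssubset hTS ⟨x₀, hx₀⟩) _ (rest_le_three hr _)) ?_ ?_ ?_ ?_
  · intro x hx
    have hx := mem_of_mem_erase hx
    refine (card_le_card ((hsub _ Subset.rfl x hx).trans
      (nb_mono ((erase_subset _ _).trans hTS) x))).trans_lt ?_
    rw [(hdata x hx).1, (hdata x hx).2.1]; norm_num
  · intro T' hT' hne'
    obtain ⟨x, hx, hc⟩ := hmin' T' (hT'.trans_ssubset (erase_ssubset hx₀)) hne'
    exact ⟨x, hx, (card_le_card (hsub T' hT' x (mem_of_mem_erase (hT' hx)))).trans hc⟩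
  · intro z hz
    refine rest_eq_self fun x hx hadj => (mem_sdiff.1 hz).2 ?_
    exact hclosed x (mem_of_mem_erase hx) z (mem_sdiff.1 hz).1 hadj.symm
  · have h3 : 3 ≤ T.card := by
      have hsub : insert x₀ (nb G T x₀) ⊆ T := insert_subset hx₀ (filter_subset _ _)
      have := card_le_card hsub
      rw [card_insert_of_notMem (self_notMem_nb _ _)] at this
      have := hT2 x₀ hx₀
      omega
    have hle : ∑ y ∈ T, cwt G S r y ≤ ∑ y ∈ T, (2 / 3 : ℝ) := by
      refine sum_le_sum fun y hy => (cwt_le_wt S r y).trans ?_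
      rw [(hdata y hy).1, (hdata y hy).2.1, wt_three le_rfl]
      norm_num
    rw [sum_const, nsmul_eq_mul] at hle
    rw [card_erase_of_mem hx₀, Nat.cast_sub (by omega)]
    have : (3 : ℝ) ≤ T.card := by exact_mod_cast h3
    push_cast
    linarith

/-! ### The weight change at a vertex in a deletion step -/

/-- The case of capacity `1` of `wt_step`. -/
theorem wt_step_one {d p q : ℕ} {n : ℝ} (hn0 : 0 ≤ n) (hD : 2 ≤ d → n * d ≤ wt 1 d) (hp : p ≤ 1)
    (hpq : p + q ≤ d) (h11 : d ≠ 1) (h1 : p = 1 → q = 0) :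
    wt 1 d + n * p ≤ wt (1 - q) (d - p - q) + q * (1 / 3 - n) := by
  rcases Nat.lt_or_ge d 2 with hd | hd
  · obtain rfl : d = 0 := by omega
    obtain rfl : p = 0 := by omega
    obtain rfl : q = 0 := by omega
    simp
  have hD := hD hd
  have hd2 : (2 : ℝ) ≤ d := by exact_mod_cast hd
  rcases Nat.eq_zero_or_pos q with rfl | hq
  · interval_cases p
    · simp
    obtain ⟨e, rfl⟩ : ∃ e, d = e + 1 := ⟨d - 1, by omega⟩
    have he : (1 : ℝ) ≤ e := by exact_mod_cast (by omega : 1 ≤ e)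
    rw [wt_one] at hD ⊢
    simp only [Nat.sub_zero, Nat.add_sub_cancel, wt_one]
    push_cast at hD ⊢
    have key : 2 / (3 * ((e : ℝ) + 1)) - 2 / (3 * ((e : ℝ) + 1 + 1)) =
        2 / (3 * ((e : ℝ) + 1 + 1)) / (e + 1) := by
      field_simp; ring
    have : n ≤ 2 / (3 * ((e : ℝ) + 1 + 1)) / (e + 1) := by
      rw [le_div_iff₀ (by positivity)]; exact hD
    linarith
  · have hp0 : p = 0 := by
      by_contra h
      have := h1 (by omega)
      omega
    subst hp0
    have hw : wt 1 d ≤ wt 1 2 := wt_anti (by norm_num) hd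
    rw [wt_one 2] at hw
    have h0 := wt_nonneg (1 - q) (d - 0 - q)
    have hq' : (1 : ℝ) ≤ q := by exact_mod_cast hq
    norm_num at hw
    have hn : n ≤ 1 / 9 := by nlinarith
    push_cast
    nlinarith

/-- The case of capacity `2` of `wt_step`. -/
theorem wt_step_two {d p q : ℕ} {n : ℝ} (hn0 : 0 ≤ n) (hn : n ≤ 2 / 9)
    (hD : 2 ≤ d → n * d ≤ wt 2 d) (hp : p ≤ 1) (hpq : p + q ≤ d)
    (h2 : d = 2 → q = 2 → n ≤ 1 / 9) :
    wt 2 d + n * p + (if 2 - q = 1 ∧ d - p - q = 2 then 1 / 18 else 0) ≤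
      wt (2 - q) (d - p - q) + q * (1 / 3 - n) := by
  rcases Nat.lt_or_ge d 2 with hd | hd
  · interval_cases d
    · obtain rfl : p = 0 := by omega
      obtain rfl : q = 0 := by omega
      simp
    · interval_cases p
      · have : q ≤ 1 := by omega
        interval_cases q
        · simp
        · norm_num [wt_two, wt_one]; linarith
      · obtain rfl : q = 0 := by omega
        norm_num [wt_two, wt_two_zero]; linarith
  have hD := hD hd
  have hd2 : (2 : ℝ) ≤ d := by exact_mod_cast hd
  have hw : wt 2 d ≤ 4 / 9 := by
    have hw : wt 2 d ≤ wt 2 2 := wt_anti (by norm_num) hd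
    rw [wt_two (d := 2) (by norm_num)] at hw
    norm_num at hw; linarith
  have h3 : 3 ≤ d → wt 2 d ≤ 1 / 3 ∧ n ≤ 1 / 9 := by
    intro hd3
    have hw3 : wt 2 d ≤ wt 2 3 := wt_anti (by norm_num) hd3
    rw [wt_two (d := 3) (by norm_num)] at hw3
    have : (3 : ℝ) ≤ d := by exact_mod_cast hd3
    norm_num at hw3
    exact ⟨by linarith, by nlinarith⟩
  have hp' : (p : ℝ) ≤ 1 := by exact_mod_cast hp
  have hp0 : (0 : ℝ) ≤ p := Nat.cast_nonneg p
  have hnp : n * p ≤ n := by nlinarith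
  rcases (by omega : q = 0 ∨ q = 1 ∨ q = 2 ∨ 3 ≤ q) with rfl | rfl | rfl | hq
  · interval_cases p
    · simp
    obtain ⟨e, rfl⟩ : ∃ e, d = e + 1 := ⟨d - 1, by omega⟩
    rw [wt_two (by omega)] at hD ⊢
    simp only [Nat.sub_zero, Nat.add_sub_cancel]
    rw [wt_two (by omega), if_neg (by omega)]
    push_cast at hD ⊢
    have key : 4 / (3 * ((e : ℝ) + 1)) - 4 / (3 * ((e : ℝ) + 1 + 1)) =
        4 / (3 * ((e : ℝ) + 1 + 1)) / (e + 1) := by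
      field_simp; ring
    have : n ≤ 4 / (3 * ((e : ℝ) + 1 + 1)) / (e + 1) := by
      rw [le_div_iff₀ (by positivity)]; exact hD
    linarith
  · rcases (by omega : d = 2 ∨ d = 3 ∨ d = 4 ∨ 5 ≤ d) with rfl | rfl | rfl | hd5
    · interval_cases p <;> norm_num [wt_two, wt_one] at hD ⊢ <;> linarith
    · interval_cases p <;> norm_num [wt_two, wt_one] at hD ⊢ <;> linarith
    · interval_cases p <;> norm_num [wt_two, wt_one] at hD ⊢ <;> linarith
    · have hw5 : wt 2 d ≤ wt 2 5 := wt_anti (by norm_num) hd5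
      rw [wt_two (d := 5) (by norm_num)] at hw5
      have hd5' : (5 : ℝ) ≤ d := by exact_mod_cast hd5
      have h0 := wt_nonneg (2 - 1) (d - p - 1)
      rw [if_neg (by omega)]
      norm_num at hw5 h0 ⊢
      nlinarith
  · have h0 := wt_nonneg (2 - 2) (d - p - 2)
    rw [if_neg (by omega)]
    push_cast
    rcases hd.eq_or_lt with rfl | hd3
    · obtain rfl : p = 0 := by omega
      have := h2 rfl rfl
      push_cast
      linarith
    · obtain ⟨h4, h5⟩ := h3 hd3
      linarith
  · obtain ⟨h4, h5⟩ := h3 (by omega)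
    have h0 := wt_nonneg (2 - q) (d - p - q)
    rw [if_neg (by omega)]
    have hq' : (3 : ℝ) ≤ q := by exact_mod_cast hq
    nlinarith

/-- The case of capacity `3` of `wt_step`. -/
theorem wt_step_three {d p q : ℕ} {n : ℝ} (hn0 : 0 ≤ n) (hn : n ≤ 2 / 9)
    (hD : 3 ≤ d → n * d ≤ wt 3 d) (hp : p ≤ 1) (hpq : p + q ≤ d) (h31 : d ≠ 1)
    (h3 : d = 2 → p = 0) :
    wt 3 d + n * p + (if 3 - q = 1 ∧ d - p - q = 2 then 1 / 18 else 0) +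
      (if d = 3 ∧ p = 1 ∧ q = 0 then 1 / 6 - n else 0) ≤
      wt (3 - q) (d - p - q) + q * (1 / 3 - n) := by
  rcases (by omega : d = 0 ∨ d = 2 ∨ 3 ≤ d) with rfl | rfl | hd
  · obtain rfl : p = 0 := by omega
    obtain rfl : q = 0 := by omega
    simp
  · obtain rfl := h3 rfl
    have : q ≤ 2 := by omega
    interval_cases q <;> norm_num [wt_two, wt_one, wt_three] <;> linarith
  have hD := hD hd
  have hd3 : (3 : ℝ) ≤ d := by exact_mod_cast hd
  have hp' : (p : ℝ) ≤ 1 := by exact_mod_cast hp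
  have hp0 : (0 : ℝ) ≤ p := Nat.cast_nonneg p
  have hnp : n * p ≤ n := by nlinarith
  have h4 : 4 ≤ d → wt 3 d ≤ 2 / 5 ∧ n ≤ 1 / 10 := by
    intro hd4
    have hw : wt 3 d ≤ wt 3 4 := wt_anti (by norm_num) hd4
    rw [wt_three (d := 4) (by norm_num)] at hw
    have : (4 : ℝ) ≤ d := by exact_mod_cast hd4
    norm_num at hw
    exact ⟨by linarith, by nlinarith⟩
  have h5 : 5 ≤ d → wt 3 d ≤ 1 / 3 ∧ n ≤ 1 / 15 := by
    intro hd5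
    have hw : wt 3 d ≤ wt 3 5 := wt_anti (by norm_num) hd5
    rw [wt_three (d := 5) (by norm_num)] at hw
    have : (5 : ℝ) ≤ d := by exact_mod_cast hd5
    norm_num at hw
    exact ⟨by linarith, by nlinarith⟩
  rcases (by omega : q = 0 ∨ q = 1 ∨ q = 2 ∨ 3 ≤ q) with rfl | rfl | rfl | hq
  · interval_cases p
    · simp
    obtain ⟨e, rfl⟩ : ∃ e, d = e + 1 := ⟨d - 1, by omega⟩
    rcases (by omega : e = 2 ∨ 3 ≤ e) with rfl | he
    · norm_num [wt_three]
    rw [wt_three (by omega)] at hD ⊢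
    simp only [Nat.sub_zero, Nat.add_sub_cancel]
    rw [wt_three (by omega), if_neg (by omega), if_neg (by omega)]
    push_cast at hD ⊢
    have key : 2 / ((e : ℝ) + 1) - 2 / ((e : ℝ) + 1 + 1) =
        2 / ((e : ℝ) + 1 + 1) / (e + 1) := by
      field_simp; ring
    have : n ≤ 2 / ((e : ℝ) + 1 + 1) / (e + 1) := by
      rw [le_div_iff₀ (by positivity)]; exact hD
    linarith
  · rw [if_neg (by omega), if_neg (by omega)]
    rcases (by omega : d = 3 ∨ d = 4 ∨ 5 ≤ d) with rfl | rfl | hd5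
    · interval_cases p <;> norm_num [wt_two, wt_three] at hD ⊢ <;> linarith
    · interval_cases p <;> norm_num [wt_two, wt_three] at hD ⊢ <;> linarith
    · obtain ⟨h6, h7⟩ := h5 hd5
      have h8 : wt 2 d ≤ wt (3 - 1) (d - p - 1) := wt_anti (by norm_num) (by omega)
      have h9 : wt 2 d = 2 / 3 * wt 3 d := by
        rw [wt_two (by omega), wt_three (by omega)]; field_simp; norm_num
      have h10 : n * 5 ≤ wt 3 d := by
        have : (5 : ℝ) ≤ d := by exact_mod_cast hd5
        nlinarith
      push_cast
      linarith
  · rw [if_neg (c := d = 3 ∧ p = 1 ∧ 2 = 0) (by omega)]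
    rcases (by omega : d = 3 ∨ d = 4 ∨ 5 ≤ d) with rfl | rfl | hd5
    · interval_cases p <;> norm_num [wt_one, wt_three] at hD ⊢ <;> linarith
    · interval_cases p <;> norm_num [wt_one, wt_three] at hD ⊢ <;> linarith
    · obtain ⟨h6, h7⟩ := h5 hd5
      have h8 := wt_nonneg (3 - 2) (d - p - 2)
      push_cast
      split_ifs <;> linarith
  · rw [if_neg (by omega), if_neg (by omega)]
    have h8 := wt_nonneg (3 - q) (d - p - q)
    have hq' : (3 : ℝ) ≤ q := by exact_mod_cast hq
    rcases (by omega : d = 3 ∨ 4 ≤ d) with rfl | hd4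
    · obtain rfl : q = 3 := by omega
      obtain rfl : p = 0 := by omega
      norm_num [wt_three] at hD h8 ⊢
      linarith
    · obtain ⟨h6, h7⟩ := h4 hd4
      nlinarith

/-- The change of weight of a vertex of capacity `r` and degree `d` in a deletion step: `p` of its
neighbours are deleted and `q` are selected. The deleted vertex weighs `n` per incident edge, and
each deleted neighbour has to be paid `n` out of the gain in weight. A selected vertex has weight
`2 / 3` and also stands on an edge at the deleted vertex, so it contributes `1 - 2 / 3 - n`. The two
conditional terms are the surplus that pays for newly tight vertices. -/
theorem wt_step {r d p q : ℕ} {n : ℝ} (hr1 : 1 ≤ r) (hr : r ≤ 3) (hn0 : 0 ≤ n) (hn : n ≤ 2 / 9)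
    (hD : 2 ≤ d → (r = 3 → 3 ≤ d) → n * d ≤ wt r d) (hp : p ≤ 1) (hpq : p + q ≤ d)
    (h31 : r = 3 → d ≠ 1) (h11 : r = 1 → d ≠ 1) (h1 : r = 1 → p = 1 → q = 0)
    (h3 : r = 3 → d = 2 → p = 0) (h2 : r = 2 → d = 2 → q = 2 → n ≤ 1 / 9) :
    wt r d + n * p + (if 2 ≤ r ∧ r - q = 1 ∧ d - p - q = 2 then 1 / 18 else 0) +
      (if r = 3 ∧ d = 3 ∧ p = 1 ∧ q = 0 then 1 / 6 - n else 0) ≤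
      wt (r - q) (d - p - q) + q * (1 / 3 - n) := by
  interval_cases r
  · have := wt_step_one hn0 (fun h => hD h (by norm_num)) hp hpq (h11 rfl) (h1 rfl)
    simpa using this
  · have := wt_step_two hn0 hn (fun h => hD h (by norm_num)) hp hpq (h2 rfl)
    simpa using this
  · have := wt_step_three hn0 hn (fun h => hD (by omega) (fun _ => h)) hp hpq (h31 rfl) (h3 rfl)
    simpa using this

/-! ### Deleting a vertex of minimal weight per edge -/

/-- The weight per incident edge of a vertex that may be deleted is at most `2 / 9`, with equality
for capacity and degree `2`. -/
theorem wt_div_le {r d : ℕ} (hr1 : 1 ≤ r) (hr : r ≤ 3) (hd : 2 ≤ d) (h3 : r = 3 → 3 ≤ d) :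
    wt r d / d ≤ 2 / 9 := by
  have hd' : (2 : ℝ) ≤ d := by exact_mod_cast hd
  rw [div_le_iff₀ (by positivity)]
  interval_cases r
  · have := wt_anti (r := 1) (by norm_num) hd
    norm_num [wt_one 2] at this
    linarith
  · have := wt_anti (r := 2) (by norm_num) hd
    norm_num [wt_two (d := 2)] at this
    linarith
  · have := wt_anti (r := 3) (by norm_num) (h3 rfl)
    norm_num [wt_three (d := 3)] at this
    have hd3 : (3 : ℝ) ≤ d := by exact_mod_cast h3 rfl
    linarith

/-- A vertex that is tight after deleting `v` and selecting its neighbours `U` of capacity `3` and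
degree `2` either lost capacity, or has a neighbour of capacity `3` whose degree dropped from `3`
to `2`: had that neighbour kept its degree, it would be an ear before the step. -/
theorem IsTight.of_sdiff {S X U : Finset V} {r : V → ℕ} {v y : V} (hXS : X ⊆ S)
    (hX : ∀ z, (nb G X z).card = (nb G {v} z).card + (nb G U z).card)
    (hr : ∀ v, r v ≤ 3)
    (hear : ∀ y ∈ S, r y = 1 → ∀ u ∈ S, r u = 3 → ∀ v, nb G S u = {y, v} → ¬ G.Adj y v)
    (hy : y ∈ S \ X) (ht : IsTight G (S \ X) (rest G U r) y) :
    (2 ≤ r y ∧ r y - (nb G U y).card = 1 ∧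
      (nb G S y).card - (nb G {v} y).card - (nb G U y).card = 2) ∨
    ∃ u ∈ S \ X, (r u = 3 ∧ (nb G S u).card = 3 ∧ (nb G {v} u).card = 1 ∧ (nb G U u).card = 0) ∧
      y ∈ (nb G (S \ X) u).filter fun y => r y = 1 ∧ 2 ≤ (nb G S y).card ∧
        ∃ w ∈ nb G (S \ X) y, G.Adj u w := by
  obtain ⟨h1, h2, u, hu, hu3, hu2, w, hw, huw⟩ := ht
  have hdy := card_nb_sdiff_add (G := G) hXS y
  have hdu := card_nb_sdiff_add (G := G) hXS u
  rw [hX] at hdy hdu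
  unfold rest at h1 hu3
  have hru := hr u
  have hpu : (nb G {v} u).card ≤ 1 := (card_le_card (filter_subset _ _)).trans (by simp)
  obtain ⟨hyS, hyX⟩ := mem_sdiff.1 hy
  obtain ⟨huX, hyu⟩ := mem_nb.1 hu
  obtain ⟨hwX, hyw⟩ := mem_nb.1 hw
  rcases Nat.lt_or_ge (r y) 2 with h | h
  · right
    have hpu1 : (nb G {v} u).card ≠ 0 := by
      intro h0
      have hcard : (nb G S u).card = 2 := by omega
      refine hear y hyS (by omega) u (mem_sdiff.1 huX).1 (by omega) w ?_ hyw
      symm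
      apply eq_of_subset_of_card_le
      · intro a ha
        rw [mem_insert, mem_singleton] at ha
        rcases ha with rfl | rfl
        · exact mem_nb.2 ⟨hyS, hyu.symm⟩
        · exact mem_nb.2 ⟨(mem_sdiff.1 hwX).1, huw⟩
      · rw [hcard, card_pair hyw.ne]
    refine ⟨u, huX, by omega, mem_filter.2 ⟨mem_nb.2 ⟨hy, hyu.symm⟩, by omega, by omega, w, hw, huw⟩⟩
  · left; omega

/-- The new tight vertices around a vertex `u` of capacity `3` whose degree drops from `3` to `2`
are paid for by the surplus `1 / 6 - n` of `u`. Their number is limited by the minimality of `n`: a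
single one forces `n ≤ 1 / 9`, and for two of them the triangle they form with `u` is either the
configuration of `HasGood.of_triangle` or contains a vertex that forces `n ≤ 1 / 18`. -/
theorem card_tight_mul_le {S X : Finset V} {r : V → ℕ} {n : ℝ}
    (hD : ∀ y ∈ S, 2 ≤ (nb G S y).card → (r y = 3 → 3 ≤ (nb G S y).card) →
      n * (nb G S y).card ≤ wt (r y) (nb G S y).card)
    (htri : ∀ y ∈ S, ∀ u y', r y = 1 → r y' = 1 → nb G S y = {u, y'} → (nb G S y').card = 2 →
      u ≠ y' → r u = 3 → (nb G S u).card ≠ 3)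
    {u : V} (hu : u ∈ S) (hu3 : r u = 3) (hd : (nb G S u).card = 3)
    (hd' : (nb G (S \ X) u).card = 2) :
    (((nb G (S \ X) u).filter fun y => r y = 1 ∧ 2 ≤ (nb G S y).card ∧
        ∃ w ∈ nb G (S \ X) y, G.Adj u w).card : ℝ) * (1 / 18) ≤ 1 / 6 - n := by
  set C := (nb G (S \ X) u).filter fun y => r y = 1 ∧ 2 ≤ (nb G S y).card ∧
        ∃ w ∈ nb G (S \ X) y, G.Adj u w with hC
  have hCle : C.card ≤ 2 := (card_le_card (filter_subset _ _)).trans hd'.le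
  have hS : ∀ y ∈ nb G (S \ X) u, y ∈ S := fun y hy => (mem_sdiff.1 (mem_nb.1 hy).1).1
  have hone : ∀ y ∈ C, ∀ e, e ≤ (nb G S y).card → n * (nb G S y).card ≤ 2 / (3 * (e + 1)) := by
    intro y hy e he
    obtain ⟨hyn, hy1, hy2, -⟩ := mem_filter.1 hy
    have := hD y (hS y hyn) hy2 (by omega)
    rw [hy1] at this
    have h1 := wt_anti (r := 1) (by norm_num) he
    rw [wt_one e] at h1
    exact this.trans h1
  rcases (by omega : C.card = 0 ∨ C.card = 1 ∨ C.card = 2) with h | h | h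
  · have := hD u hu (by omega) (by omega)
    rw [hu3, hd, wt_three (by norm_num)] at this
    norm_num [h] at this ⊢
    linarith
  · obtain ⟨y, hy⟩ := card_pos.1 (by omega : 0 < C.card)
    have h2 : (2 : ℝ) ≤ (nb G S y).card := by exact_mod_cast (mem_filter.1 hy).2.2.1
    have := hone y hy 2 (mem_filter.1 hy).2.2.1
    rw [h]
    norm_num at this ⊢
    by_contra hn
    push Not at hn
    have hn' : 1 / 9 < n := by linarith
    nlinarith
  · by_contra hn
    rw [h] at hn
    push Not at hn
    have hn' : 1 / 18 < n := by norm_num at hn; linarith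
    have hCeq : C = nb G (S \ X) u := eq_of_subset_of_card_le (filter_subset _ _) (by omega)
    have htwo : ∀ y ∈ C, (nb G S y).card = 2 := by
      intro y hy
      by_contra hne
      have h3 : 3 ≤ (nb G S y).card := by have := (mem_filter.1 hy).2.2.1; omega
      have h3' : (3 : ℝ) ≤ (nb G S y).card := by exact_mod_cast h3
      have := hone y hy 3 h3
      norm_num at this
      nlinarith
    obtain ⟨y, y', hne, hyy⟩ := card_eq_two.1 h
    have hyC : y ∈ C := by simp [hyy]
    have hyC' : y' ∈ C := by simp [hyy]
    obtain ⟨hyn, hy1, -, w, hw, huw⟩ := mem_filter.1 hyC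
    obtain ⟨hwX, hyw⟩ := mem_nb.1 hw
    have hwC : w ∈ C := by rw [hCeq]; exact mem_nb.2 ⟨hwX, huw⟩
    have hwy' : w = y' := by
      rw [hyy, mem_insert, mem_singleton] at hwC
      rcases hwC with rfl | h
      · exact absurd hyw (G.loopless.irrefl _)
      · exact h
    subst hwy'
    refine htri y (hS y hyn) u w hy1 (mem_filter.1 hyC').2.1 ?_ (htwo w hyC') huw.ne hu3 hd
    symm
    apply eq_of_subset_of_card_le
    · intro a ha
      rw [mem_insert, mem_singleton] at ha
      rcases ha with rfl | rfl
      · exact mem_nb.2 ⟨hu, (mem_nb.1 hyn).2.symm⟩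
      · exact mem_nb.2 ⟨(mem_sdiff.1 hwX).1, hyw⟩
    · rw [htwo y hyC, card_pair huw.ne]

/-- Deleting a vertex `v` whose weight per incident edge is minimal, and selecting its neighbours of
capacity `3` and degree `2`. The weight of the latter would not rise with the deletion; being left
with degree at most `1`, they can be selected instead. The hypothesis `hno4` concerns the one kind
of vertex whose loss is not covered: capacity and degree `2`, with both neighbours selected. -/
theorem HasGood.of_min {S : Finset V} {r : V → ℕ} (hr : ∀ v, r v ≤ 3)
    (hpos : ∀ v ∈ S, 1 ≤ r v)
    (ih : ∀ S' ⊂ S, ∀ r' : V → ℕ, (∀ v, r' v ≤ 3) → HasGood G S' r')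
    (h31 : ∀ y ∈ S, r y = 3 → (nb G S y).card ≠ 1)
    (h11 : ∀ y ∈ S, r y = 1 → (nb G S y).card ≠ 1)
    (hear : ∀ y ∈ S, r y = 1 → ∀ u ∈ S, r u = 3 → ∀ v, nb G S u = {y, v} → ¬ G.Adj y v)
    (htri : ∀ y ∈ S, ∀ u y', r y = 1 → r y' = 1 → nb G S y = {u, y'} → (nb G S y').card = 2 →
      u ≠ y' → r u = 3 → (nb G S u).card ≠ 3)
    {v : V} (hv : v ∈ S) (hv2 : 2 ≤ (nb G S v).card) (hv3 : r v = 3 → 3 ≤ (nb G S v).card)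
    (hmin : ∀ w ∈ S, 2 ≤ (nb G S w).card → (r w = 3 → 3 ≤ (nb G S w).card) →
      wt (r v) (nb G S v).card / (nb G S v).card ≤ wt (r w) (nb G S w).card / (nb G S w).card)
    (hno4 : ∀ y ∈ S, r y = 2 → (nb G S y).card = 2 →
      (∀ u ∈ nb G S y, r u = 3 ∧ nb G S u = {y, v}) →
      wt (r v) (nb G S v).card / (nb G S v).card ≤ 1 / 9) : HasGood G S r := by
  set n : ℝ := wt (r v) (nb G S v).card / (nb G S v).card with hn
  have hn0 : 0 ≤ n := div_nonneg (wt_nonneg _ _) (Nat.cast_nonneg _)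
  have hn29 : n ≤ 2 / 9 := wt_div_le (hpos v hv) (hr v) hv2 hv3
  have hnv : n * (nb G S v).card = wt (r v) (nb G S v).card :=
    div_mul_cancel₀ _ (by positivity)
  have hD : ∀ y ∈ S, 2 ≤ (nb G S y).card → (r y = 3 → 3 ≤ (nb G S y).card) →
      n * (nb G S y).card ≤ wt (r y) (nb G S y).card := by
    intro y hy h2 h3
    exact (le_div_iff₀ (by positivity)).1 (hmin y hy h2 h3)
  set U := (nb G S v).filter fun u => r u = 3 ∧ (nb G S u).card = 2 with hU
  have hUmem : ∀ u, u ∈ U ↔ (u ∈ S ∧ G.Adj v u) ∧ r u = 3 ∧ (nb G S u).card = 2 := by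
    intro u; rw [hU, mem_filter, mem_nb]
  have hvU : v ∉ U := fun h => G.loopless.irrefl v ((hUmem v).1 h).1.2
  set X := insert v U with hX
  have hXS : X ⊆ S := by
    intro a ha
    rcases mem_insert.1 ha with rfl | h
    · exact hv
    · exact ((hUmem a).1 h).1.1
  have hUX : U ⊆ X := subset_insert _ _
  have hXcard : ∀ z, (nb G X z).card = (nb G {v} z).card + (nb G U z).card := by
    intro z
    rw [hX, insert_eq, card_nb_union (by simpa using hvU)]
  have hSX : S \ X ⊂ S := by
    refine ⟨sdiff_subset, fun h => ?_⟩
    exact (mem_sdiff.1 (h hv)).2 (mem_insert_self _ _)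
  have hdrop : ∀ u ∈ U, ∀ T ⊆ U, (nb G (S \ X ∪ T) u).card ≤ 1 := by
    intro u hu T hT
    obtain ⟨⟨huS, hvu⟩, -, hu2⟩ := (hUmem u).1 hu
    have hsub : nb G (S \ X ∪ T) u ⊆ (nb G S u).erase v := by
      intro a ha
      obtain ⟨ha1, ha2⟩ := mem_nb.1 ha
      rcases mem_union.1 ha1 with h | h
      · refine mem_erase.2 ⟨?_, mem_nb.2 ⟨(mem_sdiff.1 h).1, ha2⟩⟩
        rintro rfl
        exact (mem_sdiff.1 h).2 (mem_insert_self _ _)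
      · refine mem_erase.2 ⟨?_, mem_nb.2 ⟨hXS (hUX (hT h)), ha2⟩⟩
        rintro rfl
        exact hvU (hT h)
    have := card_le_card hsub
    rw [card_erase_of_mem (mem_nb.2 ⟨hv, hvu.symm⟩)] at this
    omega
  refine (ih (S \ X) hSX (rest G U r) (rest_le_three hr U)).of_reduction hXS hUX ?_ ?_ ?_
  · intro u hu
    have := hdrop u hu U Subset.rfl
    have := ((hUmem u).1 hu).2.1
    omega
  · rintro T hT ⟨x, hx⟩
    exact ⟨x, hx, hdrop x (hT hx) T hT⟩
  -- the weight change of each remaining vertex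
  set P1 : V → Prop := fun y => 2 ≤ r y ∧ r y - (nb G U y).card = 1 ∧
      (nb G S y).card - (nb G {v} y).card - (nb G U y).card = 2 with hP1
  set P2 : V → Prop := fun u => r u = 3 ∧ (nb G S u).card = 3 ∧ (nb G {v} u).card = 1 ∧
      (nb G U u).card = 0 with hP2
  have hstep : ∀ y ∈ S \ X, cwt G S r y + n * (nb G {v} y).card + (if P1 y then 1 / 18 else 0) +
      (if P2 y then 1 / 6 - n else 0) ≤
      wt (rest G U r y) (nb G (S \ X) y).card + (nb G U y).card * (1 / 3 - n) := by
    intro y hy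
    obtain ⟨hyS, hyX⟩ := mem_sdiff.1 hy
    have hd := card_nb_sdiff_add (G := G) hXS y
    have hXy := hXcard y
    have hp : (nb G {v} y).card ≤ 1 := (card_le_card (filter_subset _ _)).trans (by simp)
    have hd' : (nb G (S \ X) y).card =
        (nb G S y).card - (nb G {v} y).card - (nb G U y).card := by omega
    have hadj : (nb G {v} y).card = 1 → G.Adj v y := by
      intro h
      obtain ⟨a, ha⟩ := card_pos.1 (by omega : 0 < (nb G {v} y).card)
      obtain ⟨ha1, ha2⟩ := mem_nb.1 ha
      rw [mem_singleton.1 ha1] at ha2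
      exact ha2.symm
    have hUy : ∀ u ∈ nb G U y, nb G S u = {y, v} := by
      intro u hu
      obtain ⟨huU, hyu⟩ := mem_nb.1 hu
      obtain ⟨⟨huS, hvu⟩, -, hu2⟩ := (hUmem u).1 huU
      have hyv : y ≠ v := by rintro rfl; exact hyX (mem_insert_self _ _)
      symm
      apply eq_of_subset_of_card_le
      · intro a ha
        rw [mem_insert, mem_singleton] at ha
        rcases ha with rfl | rfl
        · exact mem_nb.2 ⟨hyS, hyu.symm⟩
        · exact mem_nb.2 ⟨hv, hvu.symm⟩
      · rw [hu2, card_pair hyv]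
    have key := wt_step (r := r y) (d := (nb G S y).card) (p := (nb G {v} y).card)
      (q := (nb G U y).card) (hpos y hyS) (hr y) hn0 hn29 (hD y hyS) hp (by omega)
      (h31 y hyS) (h11 y hyS) ?_ ?_ ?_
    · rw [hd']
      have := cwt_le_wt (G := G) S r y
      unfold rest
      linarith
    · intro hy1 hpy
      by_contra hq
      obtain ⟨u, hu⟩ := card_pos.1 (Nat.pos_of_ne_zero hq)
      obtain ⟨huU, hyu⟩ := mem_nb.1 hu
      obtain ⟨⟨huS, -⟩, hu3, -⟩ := (hUmem u).1 huU
      exact hear y hyS hy1 u huS hu3 v (hUy u hu) (hadj hpy).symm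
    · intro hy3 hy2
      by_contra hpy
      exact hyX (hUX ((hUmem y).2 ⟨⟨hyS, hadj (by omega)⟩, hy3, hy2⟩))
    · intro hy2 hdy hq
      refine hno4 y hyS hy2 hdy ?_
      have hsub : nb G U y ⊆ nb G S y := nb_mono (hUX.trans hXS) y
      have heq : nb G U y = nb G S y := eq_of_subset_of_card_le hsub (by omega)
      intro u hu
      rw [← heq] at hu
      exact ⟨((hUmem u).1 (mem_nb.1 hu).1).2.1, hUy u hu⟩
  -- the vertices that become tight
  set NT := (S \ X).filter fun y => IsTight G (S \ X) (rest G U r) y with hNT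
  set C : V → Finset V := fun u => (nb G (S \ X) u).filter fun y => r y = 1 ∧
      2 ≤ (nb G S y).card ∧ ∃ w ∈ nb G (S \ X) y, G.Adj u w with hC
  have hNTsub : NT ⊆ (S \ X).filter P1 ∪ ((S \ X).filter P2).biUnion C := by
    intro y hy
    obtain ⟨hyX, ht⟩ := mem_filter.1 hy
    rcases ht.of_sdiff hXS hXcard hr hear hyX with h | ⟨u, huX, hu, hyu⟩
    · exact mem_union_left _ (mem_filter.2 ⟨hyX, h⟩)
    · exact mem_union_right _ (mem_biUnion.2 ⟨u, mem_filter.2 ⟨huX, hu⟩, hyu⟩)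
  have hNTcard : (NT.card : ℝ) * (1 / 18) ≤ ∑ y ∈ S \ X, (if P1 y then (1 / 18 : ℝ) else 0) +
      ∑ y ∈ S \ X, (if P2 y then 1 / 6 - n else 0) := by
    have h1 : (NT.card : ℝ) ≤ ((S \ X).filter P1).card + ∑ u ∈ (S \ X).filter P2, (C u).card := by
      exact_mod_cast (card_le_card hNTsub).trans
        ((card_union_le _ _).trans (Nat.add_le_add_left card_biUnion_le _))
    have h2 : ∑ u ∈ (S \ X).filter P2, ((C u).card : ℝ) * (1 / 18) ≤
        ∑ u ∈ (S \ X).filter P2, (1 / 6 - n) := by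
      refine sum_le_sum fun u hu => ?_
      obtain ⟨huX, hu3, hud, hup, huq⟩ := mem_filter.1 hu
      have := card_nb_sdiff_add (G := G) hXS u
      have := hXcard u
      exact card_tight_mul_le hD htri (mem_sdiff.1 huX).1 hu3 hud (by omega)
    rw [← sum_mul] at h2
    push_cast at h1
    rw [← sum_filter, ← sum_filter, sum_const, nsmul_eq_mul]
    linarith
  have hafter : ∑ y ∈ S \ X, cwt G (S \ X) (rest G U r) y =
      ∑ y ∈ S \ X, wt (rest G U r y) (nb G (S \ X) y).card - NT.card * (1 / 18) := by
    unfold cwt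
    rw [sum_sub_distrib, ← sum_filter, sum_const, nsmul_eq_mul]
  have hsum := sum_le_sum hstep
  simp only [sum_add_distrib] at hsum
  rw [← mul_sum, ← sum_mul] at hsum
  -- double counting of the edges from `S \ X` to `U` and to `v`: each vertex of `U` has at most one
  -- neighbour in `S \ X`, and `v` has all neighbours outside `U` there
  have hq : ∑ y ∈ S \ X, ((nb G U y).card : ℝ) ≤ U.card := by
    have h : ∑ y ∈ S \ X, (nb G U y).card ≤ U.card := by
      rw [nb_comm_card_sum]
      refine (sum_le_card_nsmul _ _ 1 fun u hu => ?_).trans (by simp)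
      have := hdrop u hu ∅ (empty_subset _)
      rwa [union_empty] at this
    exact_mod_cast h
  have hnbU : nb G X v = U := by
    ext a
    rw [mem_nb, hX, mem_insert]
    constructor
    · rintro ⟨rfl | h, h2⟩
      · exact absurd h2 (G.loopless.irrefl _)
      · exact h
    · exact fun h => ⟨Or.inr h, ((hUmem a).1 h).1.2⟩
  have hp : ∑ y ∈ S \ X, ((nb G {v} y).card : ℝ) = (nb G S v).card - U.card := by
    have h : ∑ y ∈ S \ X, (nb G {v} y).card = (nb G (S \ X) v).card := by
      rw [nb_comm_card_sum]; simp
    have h2 := card_nb_sdiff_add (G := G) hXS v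
    rw [hnbU] at h2
    rw [eq_sub_iff_add_eq]
    exact_mod_cast h ▸ h2
  have hXsum : ∑ y ∈ X, cwt G S r y ≤ wt (r v) (nb G S v).card + U.card * (2 / 3) := by
    rw [hX, sum_insert hvU]
    refine add_le_add (cwt_le_wt _ _ _) ?_
    rw [← nsmul_eq_mul]
    refine sum_le_card_nsmul _ _ _ fun u hu => (cwt_le_wt _ _ _).trans ?_
    obtain ⟨-, hu3, hu2⟩ := (hUmem u).1 hu
    rw [hu3, hu2, wt_three le_rfl]
    norm_num
  have hqn : (∑ y ∈ S \ X, ((nb G U y).card : ℝ)) * (1 / 3 - n) ≤ U.card * (1 / 3 - n) :=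
    mul_le_mul_of_nonneg_right hq (by linarith)
  rw [hp, mul_sub, hnv] at hsum
  rw [hafter]
  nlinarith

/-- Every graph with capacities at most `3` contains a good set at least as large as its total
corrected weight. -/
theorem hasGood (S : Finset V) : ∀ r : V → ℕ, (∀ v, r v ≤ 3) → HasGood G S r := by
  induction S using Finset.strongInduction with
  | H S ih =>
  intro r hr
  by_cases h0 : ∃ x ∈ S, r x = 0
  · obtain ⟨x, hx, hx0⟩ := h0
    refine HasGood.of_capacity_zero hr hx hx0 (ih _ ?_ r hr)
    exact ⟨sdiff_subset, fun h => (mem_sdiff.1 (h hx)).2 (mem_singleton_self _)⟩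
  have hpos : ∀ v ∈ S, 1 ≤ r v := by
    intro v hv
    by_contra h
    exact h0 ⟨v, hv, by omega⟩
  by_contra hcon
  have h31 : ∀ y ∈ S, r y = 3 → (nb G S y).card ≠ 1 := by
    intro y hy hy3 h
    obtain ⟨a, ha⟩ := card_eq_one.1 h
    exact hcon (HasGood.of_pendant hr hpos ih hy hy3 ha)
  have h11 : ∀ y ∈ S, r y = 1 → (nb G S y).card ≠ 1 := by
    intro y hy hy1 h
    obtain ⟨a, ha⟩ := card_eq_one.1 h
    exact hcon (HasGood.of_capacity_one_degree_one hr ih hy hy1 ha)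
  have hear : ∀ y ∈ S, r y = 1 → ∀ u ∈ S, r u = 3 → ∀ v, nb G S u = {y, v} → ¬ G.Adj y v :=
    fun y hy hy1 u hu hu3 v hnu hyv =>
      hcon (HasGood.of_ear hr hpos ih hy hy1 hu hu3 hnu hyv)
  have htri : ∀ y ∈ S, ∀ u y', r y = 1 → r y' = 1 → nb G S y = {u, y'} → (nb G S y').card = 2 →
      u ≠ y' → r u = 3 → (nb G S u).card ≠ 3 :=
    fun y hy u y' hy1 hy1' hny hny' huy' hu3 hnu =>
      hcon (HasGood.of_triangle hr ih hy hy1 hy1' hny hny' huy' hu3 hnu)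
  set D := S.filter fun v => 2 ≤ (nb G S v).card ∧ (r v = 3 → 3 ≤ (nb G S v).card) with hDdef
  by_cases hD : D.Nonempty
  · obtain ⟨v, hvD, hmin⟩ := exists_min_image D
      (fun v => wt (r v) (nb G S v).card / (nb G S v).card) hD
    obtain ⟨hv, hv2, hv3⟩ := mem_filter.1 hvD
    refine hcon (HasGood.of_min hr hpos ih h31 h11 hear htri hv hv2 hv3
      (fun w hw h2 h3 => hmin w (mem_filter.2 ⟨hw, h2, h3⟩)) ?_)
    intro y hy hy2 hdy hnu
    by_contra hn
    push Not at hn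
    obtain ⟨u₁, u₂, h12, hny⟩ := card_eq_two.1 hdy
    obtain ⟨h1, hn1⟩ := hnu u₁ (by simp [hny])
    obtain ⟨h2, hn2⟩ := hnu u₂ (by simp [hny])
    have hu1 := mem_nb.1 (by simp [hny] : u₁ ∈ nb G S y)
    have hu2 := mem_nb.1 (by simp [hny] : u₂ ∈ nb G S y)
    have hv1 := mem_nb.1 (by simp [hn1] : v ∈ nb G S u₁)
    have hv2' := mem_nb.1 (by simp [hn2] : v ∈ nb G S u₂)
    have hyv : y ≠ v := by
      rintro rfl
      have : (nb G S u₁).card = 1 := by rw [hn1]; simp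
      exact h31 u₁ hu1.1 h1 this
    have hdpos : (0 : ℝ) < (nb G S v).card := by
      have : 0 < (nb G S v).card := by omega
      exact_mod_cast this
    rw [lt_div_iff₀ hdpos] at hn
    have hrv : r v = 1 ∨ r v = 2 ∨ r v = 3 := by have := hpos v hv; have := hr v; omega
    -- the weight per edge exceeds `1 / 9` only for these two types of vertices
    have htypes : (r v = 2 ∧ (nb G S v).card = 2) ∨ (r v = 3 ∧ (nb G S v).card = 3) := by
      rcases hrv with h | h | h
      · have hx : (2 : ℝ) ≤ (nb G S v).card := by exact_mod_cast hv2
        rw [h, wt_one, lt_div_iff₀ (by positivity)] at hn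
        nlinarith
      · left
        refine ⟨h, ?_⟩
        by_contra hne
        have hx : (3 : ℝ) ≤ (nb G S v).card := by exact_mod_cast (by omega : 3 ≤ (nb G S v).card)
        rw [h, wt_two (by omega), lt_div_iff₀ (by positivity)] at hn
        nlinarith
      · right
        refine ⟨h, ?_⟩
        by_contra hne
        have := hv3 h
        have hx : (4 : ℝ) ≤ (nb G S v).card := by exact_mod_cast (by omega : 4 ≤ (nb G S v).card)
        rw [h, wt_three (by omega), lt_div_iff₀ (by positivity)] at hn
        nlinarith
    rcases htypes with ⟨hr2, hd2⟩ | ⟨hr3, hd3⟩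
    · refine hcon (HasGood.of_fourCycle_of_two hr ih hy hv hy2 h12 hyv hny h1 h2 hn1 hn2 hr2 ?_)
      symm
      apply eq_of_subset_of_card_le
      · intro a ha
        rw [mem_insert, mem_singleton] at ha
        rcases ha with rfl | rfl
        · exact mem_nb.2 ⟨hu1.1, hv1.2.symm⟩
        · exact mem_nb.2 ⟨hu2.1, hv2'.2.symm⟩
      · rw [hd2, card_pair h12]
    · exact hcon (HasGood.of_fourCycle_of_three hr ih hy hv hy2 h12 hyv hny h1 h2 hn1 hn2 hr3 hd3)
  · refine hcon (HasGood.of_card_lt hr ih fun v hv => ?_)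
    by_contra hge
    push Not at hge
    refine hD ⟨v, mem_filter.2 ⟨hv, ?_, fun h => by omega⟩⟩
    have h1 := hpos v hv
    have h3 := hr v
    have := h11 v hv
    have := h31 v hv
    by_contra hlt
    omega

/-! ### Recognising caterpillar forests -/

/-- An inner vertex: one with at least two neighbours. -/
def IsInner (G : SimpleGraph V) (x : V) : Prop :=
  ∃ y z, y ≠ z ∧ G.Adj x y ∧ G.Adj x z

/-- A vertex of a path other than its ends has two neighbours on the path. -/
theorem exists_adj_adj_of_isPath {u v x : V} {p : G.Walk u v} (hp : p.IsPath) (hx : x ∈ p.support)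
    (hxu : x ≠ u) (hxv : x ≠ v) :
    ∃ y ∈ p.support, ∃ z ∈ p.support, y ≠ z ∧ G.Adj x y ∧ G.Adj x z := by
  obtain ⟨i, hi, hil⟩ := SimpleGraph.Walk.mem_support_iff_exists_getVert.1 hx
  have h0 : i ≠ 0 := by rintro rfl; simp at hi; exact hxu hi.symm
  have hl : i ≠ p.length := by rintro rfl; simp at hi; exact hxv hi.symm
  refine ⟨p.getVert (i - 1), p.getVert_mem_support _, p.getVert (i + 1), p.getVert_mem_support _,
    fun h => ?_, ?_, ?_⟩
  · have := hp.getVert_injOn (by rw [Set.mem_ofPred_eq]; omega)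
      (by rw [Set.mem_ofPred_eq]; omega) h
    omega
  · have := p.adj_getVert_succ (i := i - 1) (by omega)
    rw [Nat.sub_add_cancel (by omega), hi] at this
    exact this.symm
  · have := p.adj_getVert_succ (i := i) (by omega)
    rwa [hi] at this

/-- A finite tree in which no vertex has three inner neighbours is a caterpillar: a longest path of
inner vertices serves as its spine. -/
theorem isCaterpillar_of_isTree [Finite V] (hG : G.IsTree)
    (hsp : ∀ x : V, ∀ f : Fin 3 → V, Function.Injective f →
      (∀ i, G.Adj x (f i) ∧ IsInner G (f i)) → False) : IsCaterpillar G := by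
  have := Fintype.ofFinite V
  refine ⟨hG, ?_⟩
  have hconn := hG.connected
  by_cases hin : ∃ x, IsInner G x
  swap
  · -- without inner vertices the tree has at most one edge
    have hne : ∀ x y z, G.Adj x y → G.Adj x z → y = z := by
      intro x y z hy hz
      by_contra h
      exact hin ⟨x, y, z, h, hy, hz⟩
    obtain ⟨u⟩ := hconn.nonempty
    by_cases hu : ∃ v, G.Adj u v
    · obtain ⟨v, huv⟩ := hu
      refine ⟨u, v, .cons huv .nil, by simp [huv.ne], fun x hx => ?_⟩
      exfalso
      obtain ⟨d, -, h1, h2⟩ := (hconn.preconnected u x).some.exists_boundary_dart {u, v} (by simp)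
        (by simpa using hx)
      have hd := d.adj
      rcases h1 with h1 | h1
      · rw [h1] at hd
        exact h2 (Or.inr (hne u _ _ hd huv))
      · rw [h1] at hd
        exact h2 (Or.inl (hne v _ _ hd huv.symm))
    · refine ⟨u, u, .nil, by simp, fun x hx => ?_⟩
      exfalso
      obtain ⟨d, -, h1, h2⟩ := (hconn.preconnected u x).some.exists_boundary_dart {u} (by simp)
        (by simpa using hx)
      have hd := d.adj
      rw [Set.mem_singleton_iff.1 h1] at hd
      exact hu ⟨_, hd⟩
  obtain ⟨w, hw⟩ := hin
  set L : Set ℕ := {n | ∃ (u v : V) (p : G.Walk u v), p.IsPath ∧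
    (∀ x ∈ p.support, IsInner G x) ∧ p.length = n} with hL
  have hbdd : BddAbove L := by
    refine ⟨Fintype.card V, ?_⟩
    rintro n ⟨u, v, p, hp, -, rfl⟩
    exact hp.length_lt.le
  obtain ⟨u, v, p, hp, hpin, hlen⟩ : sSup L ∈ L :=
    Nat.sSup_mem ⟨0, w, w, .nil, by simp, by simpa using hw, rfl⟩ hbdd
  have hmax : ∀ (u v : V) (q : G.Walk u v), q.IsPath → (∀ x ∈ q.support, IsInner G x) →
      q.length ≤ p.length := fun u v q hq hqin => hlen ▸ le_csSup hbdd ⟨u, v, q, hq, hqin, rfl⟩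
  -- an inner vertex off the path that is adjacent to it would extend it or form a spider
  have hext : ∀ b ∈ p.support, ∀ a ∉ p.support, G.Adj b a → ¬ IsInner G a := by
    intro b hb a ha hba hain
    by_cases hbu : b = u
    · subst hbu
      have := hmax _ _ (p.cons hba.symm) (hp.cons ha) (by
        intro x hx
        rw [SimpleGraph.Walk.support_cons, List.mem_cons] at hx
        rcases hx with rfl | hx
        · exact hain
        · exact hpin x hx)
      simp at this
    by_cases hbv : b = v
    · subst hbv
      have := hmax _ _ (p.concat hba) (hp.concat ha hba) (by
        intro x hx
        rw [SimpleGraph.Walk.support_concat, List.mem_append, List.mem_singleton] at hx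
        rcases hx with hx | rfl
        · exact hpin x hx
        · exact hain)
      simp at this
    obtain ⟨y, hy, z, hz, hyz, hby, hbz⟩ := exists_adj_adj_of_isPath hp hb hbu hbv
    refine hsp b ![a, y, z] ?_ ?_
    · have hay : a ≠ y := by rintro rfl; exact ha hy
      have haz : a ≠ z := by rintro rfl; exact ha hz
      intro i j hij
      fin_cases i <;> fin_cases j <;> simp_all
    · intro i
      fin_cases i
      · exact ⟨hba, hain⟩
      · exact ⟨hby, hpin y hy⟩
      · exact ⟨hbz, hpin z hz⟩
  have hcover : ∀ x, IsInner G x → x ∈ p.support := by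
    intro x hx
    by_contra hxp
    obtain ⟨q, hq⟩ := hconn.exists_isPath u x
    obtain ⟨d, hd, h1, h2⟩ := q.exists_boundary_dart {a | a ∈ p.support} p.start_mem_support hxp
    refine hext d.fst h1 d.snd h2 d.adj ?_
    by_cases hdx : d.snd = x
    · exact hdx ▸ hx
    · have hdu : d.snd ≠ u := by
        intro h
        apply h2
        rw [h]
        exact p.start_mem_support
      obtain ⟨y, -, z, -, h⟩ :=
        exists_adj_adj_of_isPath hq (q.dart_snd_mem_support_of_mem_darts hd) hdu hdx
      exact ⟨y, z, h⟩
  -- the remaining vertices are not inner; their only neighbour is on the path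
  refine ⟨u, v, p, hp, fun x hx => ?_⟩
  obtain ⟨q, hq⟩ := hconn.exists_isPath x u
  have hxu : x ≠ u := by rintro rfl; exact hx p.start_mem_support
  have hadj : G.Adj x q.snd := q.adj_snd (SimpleGraph.Walk.not_nil_of_ne hxu)
  refine ⟨q.snd, ?_, fun z => ⟨fun hz => ?_, fun h => h ▸ hadj⟩⟩
  · by_cases h : q.snd = u
    · rw [h]; exact p.start_mem_support
    · obtain ⟨y, -, z, -, h⟩ := exists_adj_adj_of_isPath hq (q.getVert_mem_support 1) hadj.ne' h
      exact hcover _ ⟨y, z, h⟩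
  · by_contra hne
    exact hx (hcover x ⟨z, q.snd, hne, hz, hadj⟩)

/-- A graph in which every nonempty vertex set contains a vertex with at most one neighbour in the
set has no cycles. -/
theorem isAcyclic_of_sparse (h : ∀ T : Finset V, T.Nonempty → ∃ x ∈ T, (nb G T x).card ≤ 1) :
    G.IsAcyclic := by
  intro v c hc
  obtain ⟨x, hx, hcard⟩ := h c.support.toFinset ⟨v, by simp⟩
  rw [List.mem_toFinset] at hx
  have h2 := hc.ncard_neighborSet_toSubgraph_eq_two hx
  have hsub : c.toSubgraph.neighborSet x ⊆ (nb G c.support.toFinset x : Set V) := by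
    intro y hy
    rw [SimpleGraph.Subgraph.mem_neighborSet] at hy
    rw [mem_coe, mem_nb, List.mem_toFinset]
    exact ⟨c.mem_verts_toSubgraph.1 hy.snd_mem, hy.adj_sub⟩
  have := Set.ncard_le_ncard hsub (Finset.finite_toSet _)
  rw [Set.ncard_coe_finset] at this
  omega

/-- A vertex set induces a caterpillar forest of maximum degree at most `k` if it is acyclic, has
degrees at most `k`, and each of its vertices has at most two neighbours of degree at least `2`. -/
theorem caterpillarForests_induce {k : ℕ} {W : Finset V}
    (hsparse : ∀ T ⊆ W, T.Nonempty → ∃ x ∈ T, (nb G T x).card ≤ 1)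
    (hdeg : ∀ x ∈ W, (nb G W x).card ≤ k)
    (hspine : ∀ x ∈ W, ((nb G W x).filter fun y => 2 ≤ (nb G W y).card).card ≤ 2) :
    caterpillarForests k W (G.induce (W : Set V)) := by
  have hac : (G.induce (W : Set V)).IsAcyclic := by
    refine isAcyclic_of_sparse fun T hT => ?_
    have hTW : T.map (Function.Embedding.subtype _) ⊆ W := by
      intro x hx
      obtain ⟨y, -, rfl⟩ := mem_map.1 hx
      exact y.2
    obtain ⟨x, hx, hc⟩ := hsparse _ hTW hT.map
    obtain ⟨y, hy, rfl⟩ := mem_map.1 hx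
    refine ⟨y, hy, le_trans ?_ hc⟩
    rw [← card_map (Function.Embedding.subtype _)]
    refine card_le_card fun z hz => ?_
    obtain ⟨z', hz', rfl⟩ := mem_map.1 hz
    obtain ⟨h1, h2⟩ := mem_nb.1 hz'
    exact mem_nb.2 ⟨mem_map_of_mem _ h1, h2⟩
  refine ⟨fun c => ?_, fun v => ?_⟩
  · refine isCaterpillar_of_isTree ⟨c.connected_toSimpleGraph,
      hac.comap c.toSimpleGraph_hom Subtype.val_injective⟩ fun x f hf h => ?_
    have hinj : Function.Injective fun i => (f i).1.1 :=
      Subtype.val_injective.comp (Subtype.val_injective.comp hf)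
    have hsub : univ.image (fun i => (f i).1.1) ⊆
        (nb G W x.1.1).filter fun y => 2 ≤ (nb G W y).card := by
      intro z hz
      obtain ⟨i, -, rfl⟩ := mem_image.1 hz
      obtain ⟨hadj, y, z, hyz, hy, hz⟩ := h i
      refine mem_filter.2 ⟨mem_nb.2 ⟨(f i).1.2, hadj⟩, ?_⟩
      have hyz' : y.1.1 ≠ z.1.1 := fun h => hyz (Subtype.ext (Subtype.ext h))
      rw [← card_pair hyz']
      refine card_le_card fun a ha => ?_
      rw [mem_insert, mem_singleton] at ha
      rcases ha with rfl | rfl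
      · exact mem_nb.2 ⟨y.1.2, hy⟩
      · exact mem_nb.2 ⟨z.1.2, hz⟩
    have h3 := (card_le_card hsub).trans (hspine x.1.1 x.1.2)
    rw [card_image_of_injective _ hinj, card_univ, Fintype.card_fin] at h3
    omega
  · refine le_trans ?_ (hdeg v.1 v.2)
    rw [← SimpleGraph.card_neighborFinset_eq_degree, ← card_map (Function.Embedding.subtype _)]
    refine card_le_card fun z hz => ?_
    obtain ⟨z', hz', rfl⟩ := mem_map.1 hz
    rw [SimpleGraph.mem_neighborFinset] at hz'
    exact mem_nb.2 ⟨z'.2, hz'⟩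

/-! ### The lower bound -/

theorem caterpillarBound_zero (k : ℕ) (ε : ℝ) : caterpillarBound k ε 0 = 1 := by
  simp [caterpillarBound]

theorem caterpillarBound_one (k : ℕ) (ε : ℝ) : caterpillarBound k ε 1 = 1 - ε := by
  simp [caterpillarBound]

theorem caterpillarBound_of_le {k d : ℕ} (ε : ℝ) (h2 : 2 ≤ d) (hd : d ≤ k) :
    caterpillarBound k ε d = 2 / ((d : ℝ) + 1) := by
  rw [caterpillarBound, if_neg (by omega), if_neg (by omega), if_pos hd]

theorem caterpillarBound_of_lt {k d : ℕ} (hk : 2 ≤ k) (ε : ℝ) (hd : k < d) :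
    caterpillarBound k ε d = min (((k : ℝ) + 1) * ε) (2 / ((d : ℝ) + 1)) := by
  rw [caterpillarBound, if_neg (by omega), if_neg (by omega), if_neg (by omega)]

theorem caterpillarBound_mem_Icc {k : ℕ} (hk : 2 ≤ k) {ε : ℝ} (h0 : 0 ≤ ε)
    (h1 : ε ≤ 2 / (((k : ℝ) + 1) * ((k : ℝ) + 2))) (d : ℕ) :
    caterpillarBound k ε d ∈ Set.Icc (0 : ℝ) 1 := by
  have hk' : (2 : ℝ) ≤ k := by exact_mod_cast hk
  have hε : ε ≤ 1 := by
    refine h1.trans ?_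
    rw [div_le_one (by positivity)]
    nlinarith
  have hfrac : 2 ≤ d → 2 / ((d : ℝ) + 1) ≤ 1 := by
    intro h
    have : (2 : ℝ) ≤ d := by exact_mod_cast h
    rw [div_le_one (by positivity)]
    linarith
  rcases (by omega : d = 0 ∨ d = 1 ∨ (2 ≤ d ∧ d ≤ k) ∨ k < d) with rfl | rfl | ⟨h, h'⟩ | h
  · simp [caterpillarBound_zero]
  · rw [caterpillarBound_one]; constructor <;> linarith
  · rw [caterpillarBound_of_le ε h h']
    exact ⟨by positivity, hfrac h⟩
  · rw [caterpillarBound_of_lt hk ε h]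
    exact ⟨le_min (by positivity) (by positivity), (min_le_right _ _).trans (hfrac (by omega))⟩

/-- For a vertex of degree at least `2` with `l` neighbours of degree `1` and `e` other neighbours,
the weight in the core is at least `f_{k,ε}` of the degree, less the amount `ε` owed to each
neighbour of degree `1`. -/
theorem caterpillarBound_sub_le_wt {k l e : ℕ} (hk : 2 ≤ k) {ε : ℝ} (h0 : 0 ≤ ε) (hd : 2 ≤ l + e) :
    caterpillarBound k ε (l + e) - l * ε ≤ wt (min 3 (k + 1 - l)) e -
      if min 3 (k + 1 - l) = 1 ∧ e = 2 then 1 / 18 else 0 := by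
  have hl0 : (0 : ℝ) ≤ l := Nat.cast_nonneg l
  have he0 : (0 : ℝ) ≤ e := Nat.cast_nonneg e
  have hlε : 0 ≤ l * ε := by positivity
  have hd' : (2 : ℝ) ≤ l + e := by exact_mod_cast hd
  rcases Nat.lt_or_ge k (l + e) with hkd | hkd
  · rw [caterpillarBound_of_lt hk ε hkd]
    set f := min (((k : ℝ) + 1) * ε) (2 / (((l + e : ℕ) : ℝ) + 1)) with hf
    have hf1 : f ≤ ((k : ℝ) + 1) * ε := min_le_left _ _
    have hf2 : f ≤ 2 / (((l + e : ℕ) : ℝ) + 1) := min_le_right _ _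
    push_cast at hf2
    rcases Nat.lt_or_ge k l with hkl | hkl
    · have : (k : ℝ) + 1 ≤ l := by exact_mod_cast hkl
      rw [show k + 1 - l = 0 by omega]
      norm_num [wt_zero]
      nlinarith
    obtain ⟨m, hm⟩ : ∃ m, k + 1 = l + m := ⟨k + 1 - l, by omega⟩
    have hmr : ((k : ℝ) + 1) = l + m := by exact_mod_cast hm
    rw [show k + 1 - l = m by omega]
    have hm0 : (0 : ℝ) ≤ m := Nat.cast_nonneg m
    have hk3 : (3 : ℝ) ≤ l + m := by exact_mod_cast (by omega : 3 ≤ l + m)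
    -- the convex combination of the two terms of the minimum with weights `l` and `m`
    have hconv : f - l * ε ≤ m * (2 / ((l : ℝ) + e + 1)) / (l + m) := by
      rw [le_div_iff₀ (by linarith)]
      rw [hmr] at hf1
      nlinarith
    rw [← mul_div_assoc, div_div] at hconv
    refine hconv.trans ?_
    rcases (by omega : m = 1 ∨ m = 2 ∨ 3 ≤ m) with rfl | rfl | h3
    · have hl2 : (2 : ℝ) ≤ l := by exact_mod_cast (by omega : 2 ≤ l)
      rw [show min 3 1 = 1 from rfl, wt_one]
      have h : ((1 : ℕ) : ℝ) * 2 / (((l : ℝ) + e + 1) * (l + ((1 : ℕ) : ℝ))) ≤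
          2 / (3 * ((e : ℝ) + 3)) := by
        push_cast
        rw [one_mul, div_le_div_iff_of_pos_left (by norm_num) (by positivity) (by positivity)]
        nlinarith
      refine h.trans ?_
      by_cases he : e = 2
      · subst he; norm_num
      · rw [if_neg (by tauto), sub_zero]
        gcongr; linarith
    · rw [show min 3 2 = 2 from rfl, wt_two (by omega), if_neg (by omega), sub_zero]
      push_cast
      have hl1 : (1 : ℝ) ≤ l := by exact_mod_cast (by omega : 1 ≤ l)
      norm_num
      rw [div_le_div_iff_of_pos_left (by norm_num) (by positivity) (by positivity)]
      nlinarith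
    · rw [min_eq_left h3, wt_three (by omega), if_neg (by omega), sub_zero,
        div_le_div_iff₀ (by positivity) (by positivity)]
      nlinarith [mul_nonneg hl0 he0, mul_nonneg hl0 hl0, mul_nonneg hl0 hm0]
  · rw [caterpillarBound_of_le ε hd hkd]
    refine (sub_le_self _ hlε).trans ?_
    have h23 : 2 / (((l + e : ℕ) : ℝ) + 1) ≤ 2 / 3 := by
      push_cast
      gcongr
      linarith
    rcases (by omega : e = 0 ∨ e = 1 ∨ 2 ≤ e) with rfl | rfl | he
    · rw [if_neg (by omega), sub_zero]
      refine h23.trans ?_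
      have h1 : min 3 (k + 1 - l) = 1 ∨ min 3 (k + 1 - l) = 2 ∨ min 3 (k + 1 - l) = 3 := by omega
      rcases h1 with h | h | h <;> rw [h] <;> norm_num [wt_one, wt_two_zero, wt_three_zero]
    · rw [if_neg (by omega), sub_zero]
      refine h23.trans ?_
      have h1 : min 3 (k + 1 - l) = 2 ∨ min 3 (k + 1 - l) = 3 := by omega
      rcases h1 with h | h <;> rw [h] <;> norm_num [wt_two, wt_three_one]
    · have h1 : min 3 (k + 1 - l) = 3 := by omega
      rw [h1, wt_three he, if_neg (by omega), sub_zero]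
      push_cast
      gcongr
      linarith

theorem card_le_maxInducedOrder [Fintype V] {C : GraphClass} {W : Finset V}
    (h : C W (G.induce (W : Set V))) : W.card ≤ maxInducedOrder C G :=
  le_sup (f := Finset.card) (mem_filter.2 ⟨mem_univ W, h⟩)

theorem card_nb_univ [Fintype V] (v : V) : (nb G univ v).card = G.degree v := by
  rw [← SimpleGraph.card_neighborFinset_eq_degree]
  congr 1
  ext a
  simp [nb]

/-- The leaves and isolated vertices are all selected. Each remaining vertex gets the capacity that
its leaves leave it, but at most `3`, so that it has at most two selected neighbours other than
leaves. -/
theorem degreeSum_caterpillarBound_le [Fintype V] (G : SimpleGraph V) {k : ℕ} (hk : 2 ≤ k) {ε : ℝ}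
    (h0 : 0 ≤ ε) :
    degreeSum (caterpillarBound k ε) G ≤ maxInducedOrder (caterpillarForests k) G := by
  set L : Finset V := univ.filter fun v => (nb G univ v).card ≤ 1 with hL
  set S : Finset V := univ \ L with hS
  have hLmem : ∀ v, v ∈ L ↔ (nb G univ v).card ≤ 1 := fun v => by simp [hL]
  set r : V → ℕ := fun v => min 3 (k + 1 - (nb G L v).card) with hr
  have hsplit : ∀ v, (nb G S v).card + (nb G L v).card = (nb G univ v).card :=
    fun v => card_nb_sdiff_add (subset_univ L) v
  obtain ⟨I, hIS, hgood, hle⟩ := hasGood (G := G) S r fun v => min_le_left _ _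
  have hdis : Disjoint I L := disjoint_left.2 fun a ha => (mem_sdiff.1 (hIS ha)).2
  -- all vertices of degree at most `1` are added to the good set
  have hW : caterpillarForests k (I ∪ L : Finset V) (G.induce ((I ∪ L : Finset V) : Set V)) := by
    have hLdeg : ∀ x ∈ L, ∀ T, (nb G T x).card ≤ 1 := fun x hx T =>
      (card_le_card (nb_mono (subset_univ T) x)).trans ((hLmem x).1 hx)
    refine caterpillarForests_induce ?_ ?_ ?_
    · intro T hT hne
      by_cases hTL : ∃ x ∈ T, x ∈ L
      · obtain ⟨x, hx, hxL⟩ := hTL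
        exact ⟨x, hx, hLdeg x hxL T⟩
      · refine hgood.sparse T (fun x hx => ?_) hne
        exact (mem_union.1 (hT hx)).resolve_right fun h => hTL ⟨x, hx, h⟩
    · intro x hx
      rcases mem_union.1 hx with hxI | hxL
      · have h1 := hgood.card_lt x hxI
        have h2 : r x ≤ k + 1 - (nb G L x).card := min_le_right _ _
        rw [card_nb_union hdis]
        omega
      · have := hLdeg x hxL (I ∪ L)
        omega
    · intro x hx
      rcases mem_union.1 hx with hxI | hxL
      · have h1 := hgood.card_lt x hxI
        have h2 : r x ≤ 3 := min_le_left _ _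
        have hsub : ((nb G (I ∪ L) x).filter fun y => 2 ≤ (nb G (I ∪ L) y).card) ⊆ nb G I x := by
          intro y hy
          obtain ⟨hyn, hy2⟩ := mem_filter.1 hy
          obtain ⟨hyW, hxy⟩ := mem_nb.1 hyn
          refine mem_nb.2 ⟨(mem_union.1 hyW).resolve_right fun h => ?_, hxy⟩
          have := hLdeg y h (I ∪ L)
          omega
        have := card_le_card hsub
        omega
      · exact (card_le_card (filter_subset _ _)).trans
          ((hLdeg x hxL (I ∪ L)).trans (by norm_num))
  have hcard : (I.card : ℝ) + L.card ≤ maxInducedOrder (caterpillarForests k) G := by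
    have := card_le_maxInducedOrder hW
    rw [card_union_of_disjoint hdis] at this
    exact_mod_cast this
  -- each leaf hands the missing amount `ε` to its neighbour in `S`
  have hsumL : ∑ v ∈ L, caterpillarBound k ε (nb G univ v).card ≤
      L.card - ∑ y ∈ S, ((nb G L y).card : ℝ) * ε := by
    have hcomm : ∑ y ∈ S, ((nb G L y).card : ℝ) = ∑ u ∈ L, ((nb G S u).card : ℝ) := by
      exact_mod_cast nb_comm_card_sum (G := G) S L
    rw [← sum_mul, hcomm, sum_mul, card_eq_sum_ones]
    push_cast
    rw [← sum_sub_distrib]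
    refine sum_le_sum fun u hu => ?_
    have h1 := (hLmem u).1 hu
    have h2 := hsplit u
    rcases (by omega : (nb G univ u).card = 0 ∨ (nb G univ u).card = 1) with h | h
    · rw [h, caterpillarBound_zero, show (nb G S u).card = 0 by omega]; simp
    · rw [h, caterpillarBound_one]
      have : ((nb G S u).card : ℝ) ≤ 1 := by exact_mod_cast (by omega : (nb G S u).card ≤ 1)
      nlinarith
  have hsumS : ∑ y ∈ S, (caterpillarBound k ε (nb G univ y).card - (nb G L y).card * ε) ≤
      ∑ y ∈ S, cwt G S r y := by
    refine sum_le_sum fun y hy => ?_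
    have hy2 : ¬ (nb G univ y).card ≤ 1 := fun h => (mem_sdiff.1 hy).2 ((hLmem y).2 h)
    have hd := hsplit y
    have := caterpillarBound_sub_le_wt (k := k) (l := (nb G L y).card) (e := (nb G S y).card) hk h0
      (by omega)
    rw [show (nb G L y).card + (nb G S y).card = (nb G univ y).card by omega] at this
    exact this.trans (wt_sub_le_cwt S r y)
  rw [sum_sub_distrib] at hsumS
  have htotal : degreeSum (caterpillarBound k ε) G =
      ∑ y ∈ S, caterpillarBound k ε (nb G univ y).card +
        ∑ y ∈ L, caterpillarBound k ε (nb G univ y).card := by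
    rw [hS, sum_sdiff (subset_univ L), degreeSum]
    exact sum_congr rfl fun v _ => by rw [card_nb_univ]
  linarith

theorem isLowerBoundFor_caterpillarBound {k : ℕ} (hk : 2 ≤ k) {ε : ℝ} (h0 : 0 ≤ ε)
    (h1 : ε ≤ 2 / (((k : ℝ) + 1) * ((k : ℝ) + 2))) :
    IsLowerBoundFor (caterpillarForests k) (caterpillarBound k ε) :=
  ⟨caterpillarBound_mem_Icc hk h0 h1, fun _ _ G => degreeSum_caterpillarBound_le G hk h0⟩

/-! ### Domination and extremality -/

theorem maxInducedOrder_le [Fintype V] {C : GraphClass} {m : ℕ}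
    (h : ∀ W : Finset V, C W (G.induce (W : Set V)) → W.card ≤ m) : maxInducedOrder C G ≤ m :=
  Finset.sup_le fun W hW => h W (mem_filter.1 hW).2

theorem not_triangle_of_caterpillarForests [Fintype V] {k : ℕ} (h : caterpillarForests k V G)
    {a b c : V} (hab : G.Adj a b) (hac : G.Adj a c) : ¬ G.Adj b c := by
  intro hbc
  set K := G.connectedComponentMk a
  have ha : a ∈ K.supp := rfl
  have hb : b ∈ K.supp := (K.mem_supp_congr_adj hab).1 ha
  have hc : c ∈ K.supp := (K.mem_supp_congr_adj hac).1 ha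
  refine (h.1 K).1.isAcyclic.cliqueFree le_rfl {⟨a, ha⟩, ⟨b, hb⟩, ⟨c, hc⟩} ?_
  exact SimpleGraph.is3Clique_triple_iff.2 ⟨hab, hac, hbc⟩

/-- The bound `2 / (d + 1)` comes from the complete graph on `d + 1` vertices. -/
theorem le_two_div_of_isLowerBoundFor {k : ℕ} {φ : ℕ → ℝ}
    (h : IsLowerBoundFor (caterpillarForests k) φ) (d : ℕ) : φ d ≤ 2 / ((d : ℝ) + 1) := by
  have hmax : maxInducedOrder (caterpillarForests k) (⊤ : SimpleGraph (Fin (d + 1))) ≤ 2 := by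
    refine maxInducedOrder_le fun W hW => ?_
    by_contra hcard
    obtain ⟨a, b, c, ha, hb, hc, hab, hac, hbc⟩ := two_lt_card_iff.1 (not_le.1 hcard)
    exact not_triangle_of_caterpillarForests hW (a := ⟨a, ha⟩) (b := ⟨b, hb⟩) (c := ⟨c, hc⟩)
      hab hac hbc
  have hdeg : ∀ v, (nb (⊤ : SimpleGraph (Fin (d + 1))) univ v).card = d := by
    intro v
    have h : nb (⊤ : SimpleGraph (Fin (d + 1))) univ v = univ.erase v := by
      ext u; simp [nb, eq_comm]
    rw [h]
    simp
  have hle := (h.2 (Fin (d + 1)) ⊤).trans (Nat.cast_le.2 hmax)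
  simp only [degreeSum, ← card_nb_univ, hdeg, sum_const, card_univ, Fintype.card_fin,
    nsmul_eq_mul] at hle
  rw [le_div_iff₀ (by positivity)]
  push_cast at hle
  linarith

/-- The complete graph on `m` vertices with `q` pendant vertices attached to each of its vertices;
`(i, none)` is a vertex of the complete graph, and `(i, some t)` are the vertices attached to it. -/
def pendantComplete (m q : ℕ) : SimpleGraph (Fin m × Option (Fin q)) where
  Adj a b := (a.2 = none ∧ b.2 = none ∧ a.1 ≠ b.1) ∨
    (a.1 = b.1 ∧ ((a.2 = none ∧ b.2 ≠ none) ∨ (a.2 ≠ none ∧ b.2 = none)))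
  symm := ⟨fun a b h => by
    rcases h with ⟨h1, h2, h3⟩ | ⟨h1, h | h⟩
    · exact Or.inl ⟨h2, h1, h3.symm⟩
    · exact Or.inr ⟨h1.symm, Or.inr ⟨h.2, h.1⟩⟩
    · exact Or.inr ⟨h1.symm, Or.inl ⟨h.2, h.1⟩⟩⟩
  loopless := ⟨fun a h => by
    rcases h with ⟨-, -, h⟩ | ⟨-, h | h⟩
    · exact h rfl
    · exact h.2 h.1
    · exact h.1 h.2⟩

theorem pendantComplete_degree_none (m q : ℕ) (i : Fin m) :
    (pendantComplete m q).degree (i, none) = (m - 1) + q := by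
  have h : nb (pendantComplete m q) univ (i, none) =
      (univ.erase i).image (fun j => (j, none)) ∪ univ.image (fun t => (i, some t)) := by
    ext ⟨j, t⟩
    cases t <;> simp [mem_nb, pendantComplete, eq_comm]
  rw [← card_nb_univ, h, card_union_of_disjoint, card_image_of_injective, card_image_of_injective,
    card_erase_of_mem (mem_univ _), card_univ, card_univ, Fintype.card_fin, Fintype.card_fin]
  · intro a b h; simpa using h
  · intro a b h; simpa using h
  · rw [disjoint_left]
    intro a ha hb
    obtain ⟨j, -, rfl⟩ := mem_image.1 ha
    simp at hb

theorem pendantComplete_degree_some (m q : ℕ) (i : Fin m) (t : Fin q) :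
    (pendantComplete m q).degree (i, some t) = 1 := by
  have h : nb (pendantComplete m q) univ (i, some t) = {(i, none)} := by
    ext ⟨j, t⟩
    cases t <;> simp [mem_nb, pendantComplete, eq_comm]
  rw [← card_nb_univ, h, card_singleton]

/-- A caterpillar forest of maximum degree at most `k` misses at least one of the `k + 2` vertices of
each star formed by a vertex and its pendant neighbours. -/
theorem maxInducedOrder_pendantComplete_le (m k : ℕ) :
    maxInducedOrder (caterpillarForests k) (pendantComplete m (k + 1)) ≤ m * (k + 1) := by
  refine maxInducedOrder_le fun W hW => ?_
  have hfib : ∀ i : Fin m, (W.filter fun a => a.1 = i).card ≤ k + 1 := by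
    intro i
    have hsub : (W.filter fun a => a.1 = i) ⊆ univ.image fun t : Option (Fin (k + 1)) => (i, t) := by
      rintro ⟨j, t⟩ ha
      obtain ⟨-, rfl⟩ := mem_filter.1 ha
      exact mem_image_of_mem _ (mem_univ t)
    have hcard : (univ.image fun t : Option (Fin (k + 1)) => (i, t)).card = k + 2 := by
      rw [card_image_of_injective _ (Prod.mk_right_injective i)]
      simp
    by_contra hlt
    have heq := eq_of_subset_of_card_le hsub (by omega)
    have hmem : ∀ t, (i, t) ∈ W := by
      intro t
      have : (i, t) ∈ W.filter fun a => a.1 = i := by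
        rw [heq]
        exact mem_image_of_mem _ (mem_univ t)
      exact (mem_filter.1 this).1
    have hdeg := hW.2 ⟨(i, none), hmem none⟩
    rw [← card_nb_univ] at hdeg
    have hstar : (univ.image fun t : Fin (k + 1) =>
        (⟨(i, some t), hmem (some t)⟩ : (W : Set (Fin m × Option (Fin (k + 1)))))).card = k + 1 := by
      rw [card_image_of_injective]
      · simp
      · intro a b h
        simpa using h
    have := card_le_card (s := univ.image fun t : Fin (k + 1) =>
        (⟨(i, some t), hmem (some t)⟩ : (W : Set (Fin m × Option (Fin (k + 1))))))
      (t := nb ((pendantComplete m (k + 1)).induce (W : Set (Fin m × Option (Fin (k + 1))))) univ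
        ⟨(i, none), hmem none⟩) (by
        intro a ha
        obtain ⟨t, -, rfl⟩ := mem_image.1 ha
        exact mem_nb.2 ⟨mem_univ _, by simp [pendantComplete]⟩)
    rw [hstar] at this
    exact absurd (this.trans hdeg) (by omega)
  calc W.card = ∑ i : Fin m, (W.filter fun a => a.1 = i).card :=
        card_eq_sum_card_fiberwise fun _ _ => mem_univ _
    _ ≤ ∑ _i : Fin m, (k + 1) := sum_le_sum fun i _ => hfib i
    _ = m * (k + 1) := by simp

/-- The relation between the values at `1` and at `d > k` comes from the complete graph on `d - k`
vertices with `k + 1` pendant vertices attached to each of its vertices. -/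
theorem le_mul_of_isLowerBoundFor {k d : ℕ} {φ : ℕ → ℝ}
    (h : IsLowerBoundFor (caterpillarForests k) φ) (hd : k < d) :
    φ d ≤ ((k : ℝ) + 1) * (1 - φ 1) := by
  obtain ⟨m, rfl⟩ : ∃ m, d = (m + 1 - 1) + (k + 1) := ⟨d - (k + 1), by omega⟩
  have hle := (h.2 _ (pendantComplete (m + 1) (k + 1))).trans
    (Nat.cast_le.2 (maxInducedOrder_pendantComplete_le (m + 1) k))
  rw [degreeSum, Fintype.sum_prod_type] at hle
  simp only [Fintype.sum_option, pendantComplete_degree_none, pendantComplete_degree_some,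
    sum_const, card_univ, Fintype.card_fin, nsmul_eq_mul] at hle
  push_cast at hle
  have hm : (0 : ℝ) < (m : ℝ) + 1 := by positivity
  have := le_of_mul_le_mul_left hle hm
  rw [Nat.add_sub_cancel]
  linarith

/-- Every lower bound is dominated by some `f_{k,ε}`. -/
theorem exists_le_caterpillarBound {k : ℕ} (hk : 2 ≤ k) {φ : ℕ → ℝ}
    (h : IsLowerBoundFor (caterpillarForests k) φ) :
    ∃ ε : ℝ, 0 ≤ ε ∧ ε ≤ 2 / (((k : ℝ) + 1) * ((k : ℝ) + 2)) ∧
      ∀ d : ℕ, φ d ≤ caterpillarBound k ε d := by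
  refine ⟨min (1 - φ 1) (2 / (((k : ℝ) + 1) * ((k : ℝ) + 2))), ?_, min_le_right _ _, fun d => ?_⟩
  · have := (h.1 1).2
    exact le_min (by linarith) (by positivity)
  rcases (by omega : d = 0 ∨ d = 1 ∨ (2 ≤ d ∧ d ≤ k) ∨ k < d) with rfl | rfl | ⟨h2, hd⟩ | hd
  · rw [caterpillarBound_zero]
    exact (h.1 0).2
  · rw [caterpillarBound_one]
    linarith [min_le_left (1 - φ 1) (2 / (((k : ℝ) + 1) * ((k : ℝ) + 2)))]
  · rw [caterpillarBound_of_le _ h2 hd]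
    exact le_two_div_of_isLowerBoundFor h d
  · rw [caterpillarBound_of_lt hk _ hd]
    refine le_min ?_ (le_two_div_of_isLowerBoundFor h d)
    rw [mul_min_of_nonneg _ _ (by positivity)]
    refine le_min (le_mul_of_isLowerBoundFor h hd) ((le_two_div_of_isLowerBoundFor h d).trans ?_)
    have hd' : (k : ℝ) + 1 ≤ d := by exact_mod_cast hd
    rw [← mul_div_assoc, mul_div_mul_left _ _ (by positivity)]
    exact div_le_div_of_nonneg_left (by norm_num) (by positivity) (by linarith)

/-- A bound exceeding `f_{k,ε}` would be dominated by some `f_{k,ε'}`, but the bounds `f_{k,ε}` are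
pairwise incomparable: `ε` enters the values at `1` and at `k + 1` with opposite signs. -/
theorem isExtremalLowerBoundFor_caterpillarBound {k : ℕ} (hk : 2 ≤ k) {ε : ℝ} (h0 : 0 ≤ ε)
    (h1 : ε ≤ 2 / (((k : ℝ) + 1) * ((k : ℝ) + 2))) :
    IsExtremalLowerBoundFor (caterpillarForests k) (caterpillarBound k ε) := by
  refine ⟨isLowerBoundFor_caterpillarBound hk h0 h1, ?_⟩
  rintro ⟨g, hg, ⟨d, hd⟩, hlb⟩
  obtain ⟨ε', -, h1', hle⟩ := exists_le_caterpillarBound hk hlb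
  have hval : ∀ δ : ℝ, δ ≤ 2 / (((k : ℝ) + 1) * ((k : ℝ) + 2)) →
      caterpillarBound k δ (k + 1) = ((k : ℝ) + 1) * δ := by
    intro δ hδ
    rw [caterpillarBound_of_lt hk _ (Nat.lt_succ_self k), min_eq_left]
    rw [le_div_iff₀ (by positivity)] at hδ ⊢
    push_cast
    linarith
  have hone := hle 1
  have htop := hle (k + 1)
  simp only [caterpillarBound_one, hval ε h1, hval ε' h1'] at hone htop
  have hεε' : ε ≤ ε' := by
    have h2 : ((k : ℝ) + 1) * ε ≤ ((k : ℝ) + 1) * ε' := by linarith [(hg (k + 1)).1]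
    exact le_of_mul_le_mul_left h2 (by positivity)
  obtain rfl : ε = ε' := le_antisymm hεε' (by linarith [(hg 1).1])
  have := hle d
  exact hd (le_antisymm (by linarith) (hg d).1)

end CaterpillarForest

theorem mainTheorem4 (k : ℕ) (hk : 2 ≤ k) :
    (∀ ε : ℝ, 0 ≤ ε → ε ≤ 2 / (((k : ℝ) + 1) * ((k : ℝ) + 2)) →
      IsExtremalLowerBoundFor (caterpillarForests k) (caterpillarBound k ε)) ∧
    (∀ φ : ℕ → ℝ, IsLowerBoundFor (caterpillarForests k) φ →
      ∃ ε : ℝ, 0 ≤ ε ∧ ε ≤ 2 / (((k : ℝ) + 1) * ((k : ℝ) + 2)) ∧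
        ∀ d : ℕ, φ d ≤ caterpillarBound k ε d) :=
  ⟨fun _ h0 h1 => CaterpillarForest.isExtremalLowerBoundFor_caterpillarBound hk h0 h1,
    fun _ h => CaterpillarForest.exists_le_caterpillarBound hk h⟩
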